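/- Theorem (Poisson transform criterion). Let $d\ge 1$. A positive finite Borel measure $\mu$ on $\mathbb{R}^d$ is called admissible if every real polynomial in $d$ variables is $\mu$-integrable; two admissible measures are moment equivalent if they give the same integral to every real polynomial; and an admissible measure $\mu$ is (moment) indeterminate if there is an admissible measure $\nu\neq\mu$ which is moment equivalent to $\mu$. For $x\in\mathbb{R}^d$ and $t>0$ let $$P(x,t)=c_d\,\frac{t}{(t^2+\|x\|^2)^{(d+1)/2}},\qquad c_d=\frac{\Gamma\left(\frac{d+1}{2}\right)}{\pi^{(d+1)/2}},$$ be the Poisson kernel, where $\|\cdot\|$ is the Euclidean norm, and for an admissible measure $\mu$ put $$\kappa_\mu(x,t)=\inf\left\{\int_{\mathbb{R}^d}(q-p)\,d\mu \;:\; p,q\in\mathbb{R}[u_1,\dots,u_d],\ p(u)\le P(x-u,t)\le q(u)\ \text{for all } u\in\mathbb{R}^d\right\}.$$ Let $\mu$ be an admissible measure on $\mathbb{R}^d$. The following are equivalent: (a) $\mu$ is indeterminate; (b) there exists $(x_0,t_0)\in\mathbb{R}^d\times(0,\infty)$ such that $\kappa_\mu(x_0,t_0)>0$; (c) for every point $(x_0,t_0)\in\mathbb{R}^d\times(0,\infty)$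 and every radius $0<r<t_0$, $$\int_{S((x_0,t_0),r)}\kappa_\mu(x,t)\,d\sigma(x,t)>0,$$ where $S((x_0,t_0),r)$ is the sphere of centre $(x_0,t_0)$ and radius $r$ in the Euclidean space $\mathbb{R}^{d}\times\mathbb{R}=\mathbb{R}^{d+1}$ and $\sigma$ is its surface area measure. -/

import Mathlib

open MeasureTheory

/-- A positive measure `μ` on `ℝ^d` is admissible if it is a finite Borel (hence Radon) measure
and every real polynomial in `d` variables is `μ`-integrable. -/
def Admissible {d : ℕ} (μ : Measure (EuclideanSpace ℝ (Fin d))) : Prop :=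
  IsFiniteMeasure μ ∧
    ∀ p : MvPolynomial (Fin d) ℝ, Integrable (fun u => MvPolynomial.eval u.ofLp p) μ

/-- Two measures on `ℝ^d` are moment equivalent if they give every polynomial the same integral. -/
def MomentEquivalent {d : ℕ} (μ ν : Measure (EuclideanSpace ℝ (Fin d))) : Prop :=
  ∀ p : MvPolynomial (Fin d) ℝ,
    ∫ u, MvPolynomial.eval u.ofLp p ∂μ = ∫ u, MvPolynomial.eval u.ofLp p ∂ν

/-- `μ` is (moment) indeterminate if another admissible measure is moment equivalent to it. -/
def MomentIndeterminate {d : ℕ} (μ : Measure (EuclideanSpace ℝ (Fin d))) : Prop :=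
  ∃ ν : Measure (EuclideanSpace ℝ (Fin d)), Admissible ν ∧ MomentEquivalent μ ν ∧ ν ≠ μ

/-- The Poisson kernel `P(x,t) = c_d t / (t² + ‖x‖²)^{(d+1)/2}` of the upper half-space, with
the usual normalization `c_d = Γ((d+1)/2) / π^{(d+1)/2}`. -/
noncomputable def poissonKernelHalfSpace {d : ℕ} (x : EuclideanSpace ℝ (Fin d)) (t : ℝ) : ℝ :=
  Real.Gamma (((d : ℝ) + 1) / 2) / Real.pi ^ (((d : ℝ) + 1) / 2) *
    (t / (t ^ 2 + ‖x‖ ^ 2) ^ (((d : ℝ) + 1) / 2))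

/-- The gap `κ_μ(x,t)`: the infimum of `∫ (q - p) dμ` over all pairs of polynomials with
`p(u) ≤ P(x-u,t) ≤ q(u)` for all `u ∈ ℝ^d`. -/
noncomputable def poissonGap {d : ℕ} (μ : Measure (EuclideanSpace ℝ (Fin d)))
    (x : EuclideanSpace ℝ (Fin d)) (t : ℝ) : ℝ :=
  sInf {s : ℝ | ∃ p q : MvPolynomial (Fin d) ℝ,
    (∀ u : EuclideanSpace ℝ (Fin d),
      MvPolynomial.eval u.ofLp p ≤ poissonKernelHalfSpace (x - u) t ∧
        poissonKernelHalfSpace (x - u) t ≤ MvPolynomial.eval u.ofLp q) ∧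
    s = ∫ u, (MvPolynomial.eval u.ofLp q - MvPolynomial.eval u.ofLp p) ∂μ}

/-- Euclidean `(d+1)`-space, written as `ℝ^d × ℝ` with its Euclidean norm. -/
abbrev PoissonSpace (d : ℕ) : Type := WithLp 2 (EuclideanSpace ℝ (Fin d) × ℝ)

/-- The surface area measure of the sphere of centre `c` and radius `r > 0` in `ℝ^d × ℝ`: the
surface area measure of the unit sphere, carried over by `ω ↦ c + r ω` and multiplied by `r^d`. -/
noncomputable def sphereSurfaceMeasure {d : ℕ} (c : PoissonSpace d) (r : ℝ) :
    Measure (PoissonSpace d) :=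
  ENNReal.ofReal (r ^ d) •
    Measure.map (fun ω : Metric.sphere (0 : PoissonSpace d) 1 => c + r • (ω : PoissonSpace d))
      (volume : Measure (PoissonSpace d)).toSphere

/-!
An indeterminate `μ` has a moment equivalent companion `ν ≠ μ`. Polynomials `p ≤ P(x - ·, t) ≤ q`
have the same integrals against both, so `κ_μ` dominates the absolute value of
`h(x, t) = ∫ P(x - u, t) dμ(u) - ∫ P(x - u, t) dν(u)`
(`integral_poissonKernelHalfSpace_sub_le_poissonGap`). If `h` vanished on a sphere inside the upper
half-space, it would vanish in the ball by the maximum principle for harmonic functions, then in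
the whole half-space by real analyticity (`integral_poissonProfile_eq_of_eq_on_sphere`), and
letting `t → 0` would give `μ = ν` (`measure_eq_of_integral_poissonProfile_eq`). Hence `κ_μ` is
positive somewhere on each sphere; it is continuous and nonnegative in the half-space
(`continuousAt_poissonGap`, `poissonGap_nonneg`), so that its integral over the sphere is positive.
A positive integral forces `κ_μ > 0` at some point.

For the remaining implication, let `U(g)` be the infimum of `∫ q dμ` over the polynomials `q ≥ g`.
By the Hahn–Banach theorem some positive functional on the polynomially bounded continuous
functions extends integration of polynomials and takes the value `U(g)` at a prescribed `g`
(`exists_positive_extension`), and by the Riesz–Markov–Kakutani theorem it is integration against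
a measure (`exists_measure_of_positive`). If `μ` is determinate, that measure is `μ`, so
`U(g) = ∫ g dμ`; applying this to the Poisson kernel and to its negative gives `κ_μ ≤ 0`
(`poissonGap_nonpos_of_determinate`).

The analytic properties of `h` come from the holomorphic extension of the Poisson kernel along
real lines in `ℝ^d × ℝ` (`lineProfile`): it is bounded uniformly in the pole, so Cauchy's estimate
permits differentiation under the integral sign.
-/

/-! ### Polynomially bounded functions and positive extensions -/

section
open Filter Topology

variable {d : ℕ}

/-- The continuous functions on `ℝ^d` whose absolute value is bounded by a polynomial. -/
def polyBounded (d : ℕ) : Submodule ℝ C(EuclideanSpace ℝ (Fin d), ℝ) where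
  carrier := {g | ∃ q : MvPolynomial (Fin d) ℝ, ∀ u, |g u| ≤ MvPolynomial.eval u.ofLp q}
  zero_mem' := ⟨0, by simp⟩
  add_mem' := by
    rintro f g ⟨p, hp⟩ ⟨q, hq⟩
    refine ⟨p + q, fun u => ?_⟩
    rw [map_add]
    exact (abs_add_le _ _).trans (add_le_add (hp u) (hq u))
  smul_mem' := by
    rintro c f ⟨p, hp⟩
    refine ⟨MvPolynomial.C |c| * p, fun u => ?_⟩
    simp only [ContinuousMap.smul_apply, smul_eq_mul, abs_mul, map_mul, MvPolynomial.eval_C]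
    exact mul_le_mul_of_nonneg_left (hp u) (abs_nonneg c)

lemma continuous_eval_ofLp (p : MvPolynomial (Fin d) ℝ) :
    Continuous fun u : EuclideanSpace ℝ (Fin d) => MvPolynomial.eval u.ofLp p :=
  (MvPolynomial.continuous_eval p).comp (PiLp.continuous_ofLp 2 _)

/-- A polynomial as an element of `polyBounded`. -/
noncomputable def polyBounded.ofPoly (p : MvPolynomial (Fin d) ℝ) : polyBounded d :=
  ⟨⟨fun u => MvPolynomial.eval u.ofLp p, continuous_eval_ofLp p⟩,
  -- `|x| ≤ 1 + x²`
  1 + p ^ 2, fun u => by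
    simp only [ContinuousMap.coe_mk, map_add, map_one, map_pow]
    rw [abs_le]
    constructor <;> nlinarith [sq_nonneg (MvPolynomial.eval u.ofLp p - 1),
      sq_nonneg (MvPolynomial.eval u.ofLp p + 1)]⟩

@[simp]
lemma polyBounded.ofPoly_apply (p : MvPolynomial (Fin d) ℝ) (u : EuclideanSpace ℝ (Fin d)) :
    (polyBounded.ofPoly p).1 u = MvPolynomial.eval u.ofLp p := rfl

/-- A bounded continuous function lies in `polyBounded`. -/
lemma mem_polyBounded_of_abs_le {g : C(EuclideanSpace ℝ (Fin d), ℝ)} {M : ℝ}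
    (h : ∀ u, |g u| ≤ M) : g ∈ polyBounded d :=
  ⟨MvPolynomial.C M, by simpa using h⟩

/-- The set of integrals of the polynomials lying above `g`. -/
def majorantIntegrals (μ : Measure (EuclideanSpace ℝ (Fin d)))
    (g : EuclideanSpace ℝ (Fin d) → ℝ) : Set ℝ :=
  {s | ∃ q : MvPolynomial (Fin d) ℝ, (∀ u : EuclideanSpace ℝ (Fin d),
    g u ≤ MvPolynomial.eval u.ofLp q) ∧ s = ∫ u, MvPolynomial.eval u.ofLp q ∂μ}

/-- The upper functional `U(g) = inf {∫ q dμ : q ≥ g}`, `q` ranging over the polynomials. -/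
noncomputable def upperIntegral (μ : Measure (EuclideanSpace ℝ (Fin d)))
    (g : EuclideanSpace ℝ (Fin d) → ℝ) : ℝ :=
  sInf (majorantIntegrals μ g)

variable {μ : Measure (EuclideanSpace ℝ (Fin d))}

lemma majorantIntegrals_nonempty (μ : Measure (EuclideanSpace ℝ (Fin d))) (g : polyBounded d) :
    (majorantIntegrals μ g.1).Nonempty := by
  obtain ⟨q, hq⟩ := g.2
  exact ⟨_, q, fun u => (le_abs_self _).trans (hq u), rfl⟩

lemma majorantIntegrals_bddBelow (hμ : Admissible μ) (g : polyBounded d) :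
    BddBelow (majorantIntegrals μ g.1) := by
  obtain ⟨q, hq⟩ := g.2
  refine ⟨-∫ u, MvPolynomial.eval u.ofLp q ∂μ, ?_⟩
  rintro _ ⟨p, hp, rfl⟩
  rw [← integral_neg]
  exact integral_mono (hμ.2 q).neg (hμ.2 p) fun u => (neg_le_of_abs_le (hq u)).trans (hp u)

lemma upperIntegral_le (hμ : Admissible μ) (g : polyBounded d) {q : MvPolynomial (Fin d) ℝ}
    (hq : ∀ u : EuclideanSpace ℝ (Fin d), g.1 u ≤ MvPolynomial.eval u.ofLp q) :
    upperIntegral μ g.1 ≤ ∫ u, MvPolynomial.eval u.ofLp q ∂μ :=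
  csInf_le (majorantIntegrals_bddBelow hμ g) ⟨q, hq, rfl⟩

lemma le_upperIntegral (g : polyBounded d) {a : ℝ}
    (h : ∀ q : MvPolynomial (Fin d) ℝ, (∀ u : EuclideanSpace ℝ (Fin d),
      g.1 u ≤ MvPolynomial.eval u.ofLp q) → a ≤ ∫ u, MvPolynomial.eval u.ofLp q ∂μ) :
    a ≤ upperIntegral μ g.1 := by
  refine le_csInf (majorantIntegrals_nonempty μ g) ?_
  rintro _ ⟨q, hq, rfl⟩
  exact h q hq

lemma upperIntegral_add_le (hμ : Admissible μ) (f g : polyBounded d) :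
    upperIntegral μ (f + g).1 ≤ upperIntegral μ f.1 + upperIntegral μ g.1 := by
  rw [← sub_le_iff_le_add']
  refine le_upperIntegral g fun q hq => ?_
  rw [sub_le_comm]
  refine le_upperIntegral f fun p hp => ?_
  rw [sub_le_iff_le_add, ← integral_add (hμ.2 p) (hμ.2 q)]
  have := upperIntegral_le hμ (f + g) (q := p + q) fun u => by
    simpa using add_le_add (hp u) (hq u)
  simpa using this

lemma upperIntegral_smul_le (hμ : Admissible μ) {c : ℝ} (hc : 0 < c) (g : polyBounded d) :
    upperIntegral μ (c • g).1 ≤ c * upperIntegral μ g.1 := by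
  rw [← div_le_iff₀' hc]
  refine le_upperIntegral g fun q hq => ?_
  rw [div_le_iff₀' hc, ← integral_const_mul]
  have := upperIntegral_le hμ (c • g) (q := MvPolynomial.C c * q) fun u => by
    simpa using mul_le_mul_of_nonneg_left (hq u) hc.le
  simpa using this

lemma upperIntegral_smul (hμ : Admissible μ) {c : ℝ} (hc : 0 < c) (g : polyBounded d) :
    upperIntegral μ (c • g).1 = c * upperIntegral μ g.1 := by
  refine (upperIntegral_smul_le hμ hc g).antisymm ?_
  have := upperIntegral_smul_le hμ (inv_pos.2 hc) (c • g)
  rw [inv_smul_smul₀ hc.ne'] at this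
  rwa [← div_eq_inv_mul, le_div_iff₀' hc] at this

/-- Hahn–Banach: the upper functional is sublinear, so that integration of polynomials extends
to a positive functional on `polyBounded` which agrees with it at a prescribed function. -/
lemma exists_positive_extension (hμ : Admissible μ) (g : polyBounded d) :
    ∃ L : polyBounded d →ₗ[ℝ] ℝ, (∀ h : polyBounded d, (∀ u, 0 ≤ h.1 u) → 0 ≤ L h) ∧
      (∀ p, L (polyBounded.ofPoly p) = ∫ u, MvPolynomial.eval u.ofLp p ∂μ) ∧
      L g = upperIntegral μ g.1 := by
  have h0 : upperIntegral μ (0 : polyBounded d).1 = 0 := by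
    have := upperIntegral_smul hμ two_pos (0 : polyBounded d)
    rw [smul_zero] at this
    linarith
  obtain ⟨L, hLg, hLN⟩ : ∃ L : polyBounded d →ₗ[ℝ] ℝ, L g = upperIntegral μ g.1 ∧
      ∀ h, L h ≤ upperIntegral μ h.1 := by
    by_cases hg : g = 0
    · obtain ⟨L, -, hL⟩ := exists_extension_of_le_sublinear (⊥ : polyBounded d →ₗ.[ℝ] ℝ)
        (fun h => upperIntegral μ h.1) (fun c hc h => upperIntegral_smul hμ hc h)
        (upperIntegral_add_le hμ) (by
          rintro ⟨x, hx⟩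
          obtain rfl : x = 0 := (Submodule.mem_bot ℝ).1 hx
          exact (LinearPMap.map_zero _).trans_le h0.ge)
      exact ⟨L, by rw [hg, map_zero, h0], hL⟩
    · obtain ⟨L, h1, hL⟩ := exists_extension_of_le_sublinear
        (LinearPMap.mkSpanSingleton g (upperIntegral μ g.1) hg)
        (fun h => upperIntegral μ h.1) (fun c hc h => upperIntegral_smul hμ hc h)
        (upperIntegral_add_le hμ) (by
          rintro ⟨x, hx⟩
          obtain ⟨c, rfl⟩ := Submodule.mem_span_singleton.1 hx
          refine (LinearPMap.mkSpanSingleton'_apply g _ _ c hx).trans_le ?_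
          simp only [RingHom.id_apply]
          rcases lt_trichotomy c 0 with hc | rfl | hc
          · -- `c U(g) ≤ U(c g)` for `c < 0`, since `0 ≤ U(c g) + U(-c g)`
            have h1 := upperIntegral_add_le hμ (c • g) ((-c) • g)
            rw [← add_smul, add_neg_cancel, zero_smul, h0,
              upperIntegral_smul hμ (neg_pos.2 hc) g] at h1
            simp only [smul_eq_mul]
            linarith
          · rw [zero_smul, zero_smul, h0]
          · rw [smul_eq_mul]
            exact (upperIntegral_smul hμ hc g).ge)
      refine ⟨L, ?_, hL⟩
      have := h1 ⟨g, Submodule.mem_span_singleton_self g⟩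
      rw [this]
      exact LinearPMap.mkSpanSingleton_apply ℝ ℝ hg _
  have hle : ∀ p, L (polyBounded.ofPoly p) ≤ ∫ u, MvPolynomial.eval u.ofLp p ∂μ := fun p =>
    (hLN _).trans (upperIntegral_le hμ _ fun u => le_rfl)
  refine ⟨L, fun h hh => ?_, fun p => (hle p).antisymm ?_, hLg⟩
  · have h1 := (hLN (-h)).trans (upperIntegral_le hμ (-h) (q := 0) fun u => by
      simpa using hh u)
    simpa using h1
  · have h1 := hle (-p)
    have h2 : polyBounded.ofPoly (-p) = -polyBounded.ofPoly p := by
      ext u; simp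
    rw [h2] at h1
    simp only [map_neg, integral_neg] at h1
    linarith

/-- A compactly supported continuous function as an element of `polyBounded`. -/
lemma compactlySupported_mem_polyBounded
    (g : CompactlySupportedContinuousMap (EuclideanSpace ℝ (Fin d)) ℝ) :
    (g : C(EuclideanSpace ℝ (Fin d), ℝ)) ∈ polyBounded d := by
  obtain ⟨M, hM⟩ := g.hasCompactSupport.exists_bound_of_continuous g.continuous
  exact mem_polyBounded_of_abs_le hM

/-- The cutoff `max 0 (1 - ‖u‖² / (n + 1))`. Its distance to `1` is at most `‖u‖² / (n + 1)`, so
that a cutoff error is controlled by a polynomial. -/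
noncomputable def cutoff (n : ℕ) (u : EuclideanSpace ℝ (Fin d)) : ℝ :=
  max 0 (1 - ‖u‖ ^ 2 / (n + 1))

lemma continuous_cutoff (n : ℕ) : Continuous (cutoff (d := d) n) := by
  unfold cutoff; fun_prop

lemma cutoff_nonneg (n : ℕ) (u : EuclideanSpace ℝ (Fin d)) : 0 ≤ cutoff n u := le_max_left _ _

lemma cutoff_le_one (n : ℕ) (u : EuclideanSpace ℝ (Fin d)) : cutoff n u ≤ 1 :=
  max_le zero_le_one (sub_le_self _ (by positivity))

lemma one_sub_cutoff_le (n : ℕ) (u : EuclideanSpace ℝ (Fin d)) :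
    1 - cutoff n u ≤ ‖u‖ ^ 2 / (n + 1) := by
  have := le_max_right 0 (1 - ‖u‖ ^ 2 / ((n : ℝ) + 1))
  unfold cutoff
  linarith

lemma hasCompactSupport_cutoff (n : ℕ) : HasCompactSupport (cutoff (d := d) n) := by
  refine HasCompactSupport.intro (isCompact_closedBall 0 ((n : ℝ) + 1)) fun u hu => ?_
  have h1 : (n : ℝ) + 1 < ‖u‖ := by simpa using hu
  have h0 : (0 : ℝ) < n + 1 := by positivity
  refine max_eq_left (sub_nonpos.2 ?_)
  rw [le_div_iff₀ h0]
  nlinarith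

lemma tendsto_cutoff (u : EuclideanSpace ℝ (Fin d)) :
    Tendsto (fun n => cutoff n u) atTop (𝓝 1) := by
  have h : Tendsto (fun n : ℕ => ‖u‖ ^ 2 / ((n : ℝ) + 1)) atTop (𝓝 0) := by
    have := (tendsto_one_div_add_atTop_nhds_zero_nat (𝕜 := ℝ)).const_mul (‖u‖ ^ 2)
    simpa [div_eq_mul_inv] using this
  have h2 : Tendsto (fun n => cutoff n u) atTop (𝓝 (max 0 (1 - 0))) :=
    tendsto_const_nhds.max (h.const_sub 1)
  simpa using h2

/-- The product of `g` with a cutoff. -/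
noncomputable def cutoffMul (n : ℕ) (g : C(EuclideanSpace ℝ (Fin d), ℝ)) :
    CompactlySupportedContinuousMap (EuclideanSpace ℝ (Fin d)) ℝ where
  toFun u := cutoff n u * g u
  continuous_toFun := (continuous_cutoff n).mul g.continuous
  hasCompactSupport' := (hasCompactSupport_cutoff n).mul_right

@[simp]
lemma cutoffMul_apply (n : ℕ) (g : C(EuclideanSpace ℝ (Fin d), ℝ)) (u) :
    cutoffMul n g u = cutoff n u * g u := rfl

/-- The polynomial `‖u‖²`. -/
noncomputable def normSqPoly (d : ℕ) : MvPolynomial (Fin d) ℝ := ∑ i, MvPolynomial.X i ^ 2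

lemma eval_normSqPoly (u : EuclideanSpace ℝ (Fin d)) :
    MvPolynomial.eval u.ofLp (normSqPoly d) = ‖u‖ ^ 2 := by
  simp [normSqPoly, EuclideanSpace.norm_sq_eq]

/-- The inclusion of the compactly supported continuous functions in `polyBounded`. -/
noncomputable def compactlySupportedToPolyBounded (d : ℕ) :
    CompactlySupportedContinuousMap (EuclideanSpace ℝ (Fin d)) ℝ →ₗ[ℝ] polyBounded d where
  toFun g := ⟨g, compactlySupported_mem_polyBounded g⟩
  map_add' _ _ := rfl
  map_smul' _ _ := rfl

/-- A positive functional on `polyBounded` is integration against a measure: the measure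
representing it on compactly supported functions does so everywhere, because cutoff errors are
bounded by polynomials with small coefficients. -/
lemma exists_measure_of_positive (L : polyBounded d →ₗ[ℝ] ℝ)
    (hL : ∀ h : polyBounded d, (∀ u, 0 ≤ h.1 u) → 0 ≤ L h) :
    ∃ ν : Measure (EuclideanSpace ℝ (Fin d)), ∀ g : polyBounded d,
      Integrable g.1 ν ∧ ∫ u, g.1 u ∂ν = L g := by
  have hmono : ∀ f g : polyBounded d, (∀ u, f.1 u ≤ g.1 u) → L f ≤ L g := fun f g h => by
    have := hL (g - f) fun u => by simpa using h u
    rwa [map_sub, sub_nonneg] at this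
  let J := compactlySupportedToPolyBounded d
  let Λ : CompactlySupportedContinuousMap (EuclideanSpace ℝ (Fin d)) ℝ →ₚ[ℝ] ℝ :=
    PositiveLinearMap.mk₀ (L ∘ₗ J) fun g hg => hL _ fun u => hg u
  let ν := RealRMK.rieszMeasure Λ
  have hΛ : ∀ g, ∫ u, g u ∂ν = L (J g) := fun g => RealRMK.integral_rieszMeasure Λ g
  refine ⟨ν, fun g => ?_⟩
  -- Fatou's lemma for the cutoffs of `|g|`, whose integrals are bounded by `L |g|`
  have hint : Integrable g.1 ν := by
    let a : polyBounded d := ⟨⟨fun u => |g.1 u|, g.1.continuous.abs⟩, by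
      obtain ⟨q, hq⟩ := g.2
      exact ⟨q, fun u => by simpa using hq u⟩⟩
    refine ⟨g.1.continuous.aestronglyMeasurable, ?_⟩
    have hb : ∀ n, ∫⁻ u, ENNReal.ofReal (cutoffMul n a.1 u) ∂ν ≤ ENNReal.ofReal (L a) := by
      intro n
      rw [← ofReal_integral_eq_lintegral_ofReal, hΛ]
      · refine ENNReal.ofReal_le_ofReal (hmono _ _ fun u => ?_)
        exact mul_le_of_le_one_left (abs_nonneg _) (cutoff_le_one n u)
      · exact (cutoffMul n a.1).continuous.integrable_of_hasCompactSupport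
          (cutoffMul n a.1).hasCompactSupport
      · exact Eventually.of_forall fun u => mul_nonneg (cutoff_nonneg n u) (abs_nonneg _)
    have hlim : ∀ u, liminf (fun n => ENNReal.ofReal (cutoffMul n a.1 u)) atTop = ‖g.1 u‖ₑ := by
      intro u
      have h1 := (tendsto_cutoff u).mul_const (a.1 u)
      rw [one_mul] at h1
      have h2 := (ENNReal.tendsto_ofReal h1).liminf_eq
      rw [show ‖g.1 u‖ₑ = ENNReal.ofReal (a.1 u) from Real.enorm_eq_ofReal_abs _]
      exact h2
    have h := lintegral_liminf_le (μ := ν) (u := atTop)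
      (f := fun n u => ENNReal.ofReal (cutoffMul n a.1 u))
      (fun n => (cutoffMul n a.1).continuous.measurable.ennreal_ofReal)
    simp only [hlim] at h
    refine lt_of_le_of_lt (h.trans (liminf_le_of_le (by isBoundedDefault) fun b hb' => ?_))
      (ENNReal.ofReal_lt_top (r := L a))
    obtain ⟨n, hn⟩ := hb'.exists
    exact hn.trans (hb n)
  refine ⟨hint, ?_⟩
  have hlim1 : Tendsto (fun n => ∫ u, cutoffMul n g.1 u ∂ν) atTop (𝓝 (∫ u, g.1 u ∂ν)) := by
    refine MeasureTheory.tendsto_integral_of_dominated_convergence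
      (F := fun n u => cutoffMul n g.1 u) (fun u => ‖g.1 u‖)
      (fun n => (cutoffMul n g.1).continuous.aestronglyMeasurable) hint.norm
      (fun n => Eventually.of_forall fun u => ?_) (Eventually.of_forall fun u => ?_)
    · rw [cutoffMul_apply, norm_mul, Real.norm_of_nonneg (cutoff_nonneg n u)]
      exact mul_le_of_le_one_left (norm_nonneg _) (cutoff_le_one n u)
    · have h1 := (tendsto_cutoff u).mul_const (g.1 u)
      rwa [one_mul] at h1
  refine tendsto_nhds_unique hlim1 ?_
  obtain ⟨q, hq⟩ := g.2
  have herr : ∀ n : ℕ, |L (J (cutoffMul n g.1)) - L g| ≤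
      L (polyBounded.ofPoly (q * normSqPoly d)) * (1 / ((n : ℝ) + 1)) := by
    intro n
    have hpt : ∀ u, |(J (cutoffMul n g.1) - g).1 u| ≤
        ((1 / ((n : ℝ) + 1)) • polyBounded.ofPoly (q * normSqPoly d)).1 u := by
      intro u
      have h1 : (J (cutoffMul n g.1) - g).1 u = -((1 - cutoff n u) * g.1 u) := by
        change cutoff n u * g.1 u - g.1 u = _
        ring
      have h2 : ((1 / ((n : ℝ) + 1)) • polyBounded.ofPoly (q * normSqPoly d)).1 u
          = ‖u‖ ^ 2 / (n + 1) * MvPolynomial.eval u.ofLp q := by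
        change (1 / ((n : ℝ) + 1)) * MvPolynomial.eval u.ofLp (q * normSqPoly d) = _
        rw [map_mul, eval_normSqPoly]
        ring
      rw [h1, h2, abs_neg, abs_mul, abs_of_nonneg (sub_nonneg.2 (cutoff_le_one n u))]
      exact mul_le_mul (one_sub_cutoff_le n u) (hq u) (abs_nonneg _) (by positivity)
    rw [← map_sub, mul_comm, ← smul_eq_mul, ← map_smul, abs_le, ← map_neg]
    constructor
    · refine hmono _ _ fun u => ?_
      exact neg_le_of_abs_le (hpt u)
    · exact hmono _ _ fun u => le_of_abs_le (hpt u)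
  simp only [hΛ]
  rw [tendsto_iff_norm_sub_tendsto_zero]
  refine squeeze_zero (fun n => norm_nonneg _) herr ?_
  simpa using (tendsto_one_div_add_atTop_nhds_zero_nat (𝕜 := ℝ)).const_mul
    (L (polyBounded.ofPoly (q * normSqPoly d)))

/-- If `μ` is determinate, every polynomially bounded continuous function has its integral as
the greatest lower bound of the integrals of polynomials above it. -/
lemma upperIntegral_eq_integral (hμ : Admissible μ) (hdet : ¬ MomentIndeterminate μ)
    (g : polyBounded d) : upperIntegral μ g.1 = ∫ u, g.1 u ∂μ := by
  obtain ⟨L, hL, hLp, hLg⟩ := exists_positive_extension hμ g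
  obtain ⟨ν, hν⟩ := exists_measure_of_positive L hL
  have hνμ : ν = μ := by
    by_contra hne
    refine hdet ⟨ν, ⟨?_, fun p => (hν (polyBounded.ofPoly p)).1⟩, fun p => ?_, hne⟩
    · have h1 := (hν (polyBounded.ofPoly 1)).1
      have h2 : Integrable (fun _ : EuclideanSpace ℝ (Fin d) => (1 : ℝ)) ν := by
        refine h1.congr (Eventually.of_forall fun u => by simp)
      exact (integrable_const_iff_isFiniteMeasure one_ne_zero).1 h2
    · rw [← hLp, ← (hν (polyBounded.ofPoly p)).2]
      rfl
  rw [← hLg, ← (hν g).2, hνμ]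

end

/-! ### Holomorphic families under the integral sign and the maximum principle -/

section
open Filter Topology Metric

lemma norm_deriv_le_of_norm_le_on_ball {f : ℂ → ℂ} {s₀ : ℂ} {R M : ℝ} (hR : 0 < R)
    (hd : DifferentiableOn ℂ f (ball s₀ R)) (hM : ∀ s ∈ ball s₀ R, ‖f s‖ ≤ M)
    {s : ℂ} (hs : s ∈ ball s₀ (R / 2)) : ‖deriv f s‖ ≤ M / (R / 4) := by
  have hsub : closedBall s (R / 4) ⊆ ball s₀ R := by
    refine closedBall_subset_ball' ?_
    have := mem_ball.1 hs
    linarith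
  exact Complex.norm_deriv_le_of_forall_mem_sphere_norm_le (by positivity)
    ((hd.mono (closure_ball_subset_closedBall.trans hsub)).diffContOnCl)
    fun w hw => hM w (hsub (sphere_subset_closedBall hw))

variable {X : Type*} [MeasurableSpace X] {μ : Measure X}

lemma measurable_deriv_of_differentiableAt {F : ℂ → X → ℂ} {s : ℂ}
    (hF : ∀ᶠ w in 𝓝 s, Measurable (F w)) (hd : ∀ u, DifferentiableAt ℂ (fun w => F w u) s) :
    Measurable fun u => deriv (fun w => F w u) s := by
  have hlim : Tendsto (fun n : ℕ => s + 1 / ((n : ℂ) + 1)) atTop (𝓝 s) := by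
    simpa using (tendsto_one_div_add_atTop_nhds_zero_nat (𝕜 := ℂ)).const_add s
  obtain ⟨N, hN⟩ := (hlim.eventually hF).exists_forall_of_atTop
  refine measurable_of_tendsto_metrizable
    (f := fun n u => slope (fun w => F w u) s (s + 1 / (((n + N : ℕ) : ℂ) + 1))) (fun n => ?_) ?_
  · simp only [slope_def_field]
    exact ((hN (n + N) (Nat.le_add_left _ _)).sub hF.self_of_nhds).div_const _
  · rw [tendsto_pi_nhds]
    intro u
    have h1 := (hd u).hasDerivAt.tendsto_slope
    refine h1.comp (tendsto_nhdsWithin_iff.2 ⟨hlim.comp (tendsto_add_atTop_nat N), ?_⟩)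
    refine Eventually.of_forall fun n => ?_
    simp only [Set.mem_compl_iff, Set.mem_singleton_iff, add_eq_left]
    exact one_div_ne_zero (Nat.cast_add_one_ne_zero _)

/-- Differentiation under the integral sign for a bounded family of holomorphic functions; the
derivatives are dominated by Cauchy's estimate. -/
lemma hasDerivAt_integral_of_bounded_holomorphic [IsFiniteMeasure μ] {F : ℂ → X → ℂ} {s₀ : ℂ}
    {R M : ℝ} (hR : 0 < R) (hmeas : ∀ s ∈ ball s₀ R, Measurable (F s))
    (hd : ∀ u, DifferentiableOn ℂ (fun s => F s u) (ball s₀ R))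
    (hM : ∀ u, ∀ s ∈ ball s₀ R, ‖F s u‖ ≤ M) :
    Integrable (fun u => deriv (fun s => F s u) s₀) μ ∧
      HasDerivAt (fun s => ∫ u, F s u ∂μ) (∫ u, deriv (fun s => F s u) s₀ ∂μ) s₀ := by
  have h0 : s₀ ∈ ball s₀ R := mem_ball_self hR
  have hev : ∀ᶠ s in 𝓝 s₀, Measurable (F s) :=
    (isOpen_ball.eventually_mem h0).mono hmeas
  have hda : ∀ u, ∀ s ∈ ball s₀ R, DifferentiableAt ℂ (fun s => F s u) s := fun u s hs =>
    (hd u).differentiableAt (isOpen_ball.mem_nhds hs)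
  refine hasDerivAt_integral_of_dominated_loc_of_deriv_le (bound := fun _ => M / (R / 4))
    (F' := fun s u => deriv (fun s => F s u) s)
    (ball_mem_nhds s₀ (half_pos hR)) (hev.mono fun s hs => hs.aestronglyMeasurable) ?_
    (measurable_deriv_of_differentiableAt hev fun u => hda u s₀ h0).aestronglyMeasurable ?_
    (integrable_const _) ?_
  · exact Integrable.of_bound (hmeas s₀ h0).aestronglyMeasurable M
      (Eventually.of_forall fun u => hM u s₀ h0)
  · exact Eventually.of_forall fun u s hs =>
      norm_deriv_le_of_norm_le_on_ball hR (hd u) (hM u) hs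
  · exact Eventually.of_forall fun u s hs =>
      (hda u s (ball_subset_ball (half_le_self hR.le) hs)).hasDerivAt

/-- Second derivative under the integral sign for a bounded family of holomorphic functions. -/
lemma hasDerivAt_deriv_integral_of_bounded_holomorphic [IsFiniteMeasure μ] {F : ℂ → X → ℂ}
    {s₀ : ℂ} {R M : ℝ} (hR : 0 < R) (hmeas : ∀ s ∈ ball s₀ R, Measurable (F s))
    (hd : ∀ u, DifferentiableOn ℂ (fun s => F s u) (ball s₀ R))
    (hM : ∀ u, ∀ s ∈ ball s₀ R, ‖F s u‖ ≤ M) :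
    Integrable (fun u => deriv (deriv fun s => F s u) s₀) μ ∧
      HasDerivAt (fun s => ∫ u, deriv (fun s => F s u) s ∂μ)
        (∫ u, deriv (deriv fun s => F s u) s₀ ∂μ) s₀ := by
  have hsub : ball s₀ (R / 2) ⊆ ball s₀ R := ball_subset_ball (half_le_self hR.le)
  refine hasDerivAt_integral_of_bounded_holomorphic (F := fun s u => deriv (fun s => F s u) s)
    (half_pos hR) (fun s hs => ?_) (fun u => ?_)
    (fun u s hs => norm_deriv_le_of_norm_le_on_ball hR (hd u) (hM u) hs)
  · exact measurable_deriv_of_differentiableAt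
      ((isOpen_ball.eventually_mem (hsub hs)).mono hmeas)
      fun u => (hd u).differentiableAt (isOpen_ball.mem_nhds (hsub hs))
  · exact ((hd u).deriv isOpen_ball).mono hsub

lemma second_deriv_nonpos_of_isLocalMax {φ φ' : ℝ → ℝ} {D x : ℝ} (hmax : IsLocalMax φ x)
    (h1 : ∀ᶠ s in 𝓝 x, HasDerivAt φ (φ' s) s) (h2 : HasDerivAt φ' D x) : D ≤ 0 := by
  by_contra! hD
  have hd : deriv φ =ᶠ[𝓝 x] φ' := h1.mono fun s hs => hs.deriv
  have hdd : deriv (deriv φ) x = D := (h2.congr_of_eventuallyEq hd).deriv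
  have hmin : IsLocalMin φ x := isLocalMin_of_deriv_deriv_pos (by rwa [hdd]) hmax.deriv_eq_zero
    h1.self_of_nhds.continuousAt
  have hconst : φ =ᶠ[𝓝 x] fun _ => φ x := by
    filter_upwards [hmax, hmin] with s hs hs' using hs.antisymm hs'
  have h3 : deriv (deriv φ) x = 0 := by
    rw [hconst.deriv.deriv_eq]
    simp
  linarith

variable {V ι : Type*} [NormedAddCommGroup V] [InnerProductSpace ℝ V] [Fintype ι]

/-- `h` is twice differentiable along each basis direction at `z`, and the sum of its second
derivatives there vanishes. -/
def LaplaceEquationAt (b : OrthonormalBasis ι ℝ V) (h : V → ℝ) (z : V) : Prop :=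
  ∃ (φ' : ι → ℝ → ℝ) (D : ι → ℝ), ∑ i, D i = 0 ∧ ∀ i,
    (∀ᶠ s in 𝓝 (0 : ℝ), HasDerivAt (fun s : ℝ => h (z + s • b i)) (φ' i s) s) ∧
      HasDerivAt (φ' i) (D i) 0

/-- The weak maximum principle on a ball: adding `ε ‖z - c‖²` makes the Laplacian positive, which
excludes an interior maximum. -/
lemma nonpos_on_ball_of_laplaceEquationAt [Nonempty ι] (b : OrthonormalBasis ι ℝ V) {h : V → ℝ}
    {c : V} {r : ℝ} (hcont : ContinuousOn h (closedBall c r))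
    (hlap : ∀ z ∈ ball c r, LaplaceEquationAt b h z) (hs : ∀ z ∈ sphere c r, h z ≤ 0) :
    ∀ z ∈ ball c r, h z ≤ 0 := by
  intro z₀ hz₀
  by_contra! hpos
  have hr : 0 < r := pos_of_mem_ball hz₀
  have : FiniteDimensional ℝ V := b.toBasis.finiteDimensional_of_finite
  -- the perturbation is too small to make up for `h z₀` on the sphere
  obtain ⟨ε, hε, hεr⟩ : ∃ ε : ℝ, 0 < ε ∧ ε * r ^ 2 < h z₀ := by
    refine ⟨h z₀ / (2 * r ^ 2), by positivity, ?_⟩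
    have : h z₀ / (2 * r ^ 2) * r ^ 2 = h z₀ / 2 := by field_simp
    linarith
  let w : V → ℝ := fun z => h z + ε * ‖z - c‖ ^ 2
  have hw : ContinuousOn w (closedBall c r) := hcont.add (by fun_prop)
  obtain ⟨y, hy, hymax⟩ := (isCompact_closedBall c r).exists_isMaxOn
    ⟨z₀, ball_subset_closedBall hz₀⟩ hw
  have hyz : h z₀ ≤ w y := by
    have h1 : w z₀ ≤ w y := hymax (ball_subset_closedBall hz₀)
    have h2 : 0 ≤ ε * ‖z₀ - c‖ ^ 2 := by positivity
    simp only [w] at h1 ⊢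
    linarith
  have hyb : y ∈ ball c r := by
    rcases (mem_closedBall.1 hy).lt_or_eq with h1 | h1
    · exact h1
    · exfalso
      have h2 := hs y h1
      have h3 : w y = h y + ε * r ^ 2 := by simp only [w]; rw [← dist_eq_norm, h1]
      linarith
  obtain ⟨φ', D, hD, hφ⟩ := hlap y hyb
  have key : ∀ i, D i + 2 * ε ≤ 0 := by
    intro i
    have hline : Continuous fun s : ℝ => y + s • b i := by fun_prop
    have hmax : IsLocalMax (fun s : ℝ => w (y + s • b i)) 0 := by
      have h1 : ∀ᶠ s in 𝓝 (0 : ℝ), y + s • b i ∈ ball c r :=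
        hline.continuousAt.eventually (isOpen_ball.mem_nhds (by simpa using hyb))
      filter_upwards [h1] with s hs
      simpa using hymax (ball_subset_closedBall hs)
    have hsq : ∀ s : ℝ, ‖y + s • b i - c‖ ^ 2 =
        ‖y - c‖ ^ 2 + s * (2 * inner ℝ (y - c) (b i)) + s ^ 2 := by
      intro s
      rw [add_sub_right_comm, norm_add_sq_real, inner_smul_right, norm_smul, b.norm_eq_one,
        mul_one, Real.norm_eq_abs, sq_abs]
      ring
    refine second_deriv_nonpos_of_isLocalMax hmax
      (φ' := fun s => φ' i s + ε * (2 * inner ℝ (y - c) (b i) + 2 * s)) ?_ ?_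
    · filter_upwards [(hφ i).1] with s hs
      simp only [w, hsq]
      refine hs.add (HasDerivAt.const_mul ε ?_)
      have h1 := (((hasDerivAt_id s).mul_const (2 * inner ℝ (y - c) (b i))).const_add
        (‖y - c‖ ^ 2)).add (hasDerivAt_pow 2 s)
      exact h1.congr_deriv (by simp)
    · have h1 := (((hasDerivAt_id (0 : ℝ)).const_mul 2).const_add
        (2 * inner ℝ (y - c) (b i))).const_mul ε
      exact ((hφ i).2.add h1).congr_deriv (by ring)
  have hsum : ∑ i, (D i + 2 * ε) ≤ 0 := Finset.sum_nonpos fun i _ => key i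
  rw [Finset.sum_add_distrib, hD, Finset.sum_const, nsmul_eq_mul] at hsum
  have hcard : (0 : ℝ) < Fintype.card ι := by exact_mod_cast Fintype.card_pos
  have : 0 < (Fintype.card ι : ℝ) * (2 * ε) := by positivity
  rw [Finset.card_univ] at hsum
  linarith

end

/-! ### The Poisson kernel along complexified lines -/

section
open Filter Topology Metric Complex

variable {d : ℕ}

/-- The point `(u, 0)` of the boundary hyperplane. -/
def boundaryPoint (u : EuclideanSpace ℝ (Fin d)) : PoissonSpace d := WithLp.toLp 2 (u, 0)

/-- The Poisson kernel with pole `u`, up to its constant: `t (‖(x, t) - (u, 0)‖²)^{-a}`, with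
`a = (d + 1) / 2` in the application. -/
noncomputable def poissonProfile (a : ℝ) (z : PoissonSpace d) (u : EuclideanSpace ℝ (Fin d)) : ℝ :=
  z.snd * (‖z - boundaryPoint u‖ ^ 2) ^ (-a)

/-- The polynomial in a complex variable `s` which equals `‖z + s v - (u, 0)‖²` for real `s`. -/
noncomputable def lineQuad (z v : PoissonSpace d) (u : EuclideanSpace ℝ (Fin d)) (s : ℂ) : ℂ :=
  ((‖z - boundaryPoint u‖ ^ 2 : ℝ) : ℂ) + 2 * s * ((inner ℝ (z - boundaryPoint u) v : ℝ) : ℂ) +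
    s ^ 2 * ((‖v‖ ^ 2 : ℝ) : ℂ)

/-- The extension of `s ↦ poissonProfile a (z + s v) u` to complex `s`. -/
noncomputable def lineProfile (a : ℝ) (z v : PoissonSpace d) (s : ℂ)
    (u : EuclideanSpace ℝ (Fin d)) : ℂ :=
  ((z.snd : ℂ) + s * v.snd) * lineQuad z v u s ^ ((-a : ℝ) : ℂ)

/-- A convex complex neighbourhood of the real `s` for which `z + s v` lies in the upper
half-space; `lineProfile` is holomorphic there. -/
def lineDomain (z v : PoissonSpace d) : Set ℂ := {s | |s.im| * ‖v‖ < z.snd + s.re * v.snd}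

@[simp]
lemma snd_boundaryPoint (u : EuclideanSpace ℝ (Fin d)) : (boundaryPoint u).snd = 0 := rfl

@[simp]
lemma fst_boundaryPoint (u : EuclideanSpace ℝ (Fin d)) : (boundaryPoint u).fst = u := rfl

lemma continuous_boundaryPoint :
    Continuous (boundaryPoint : EuclideanSpace ℝ (Fin d) → PoissonSpace d) := by
  unfold boundaryPoint; fun_prop

lemma isOpen_lineDomain (z v : PoissonSpace d) : IsOpen (lineDomain z v) :=
  isOpen_lt (by fun_prop) (by fun_prop)

lemma convex_lineDomain (z v : PoissonSpace d) : Convex ℝ (lineDomain z v) := by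
  intro s hs w hw α β hα hβ hαβ
  simp only [lineDomain, Set.mem_ofPred_eq] at hs hw ⊢
  have h1 : |(α • s + β • w).im| ≤ α * |s.im| + β * |w.im| := by
    simp only [add_im, real_smul, mul_im, ofReal_re, ofReal_im, zero_mul, add_zero]
    refine (abs_add_le _ _).trans_eq ?_
    rw [abs_mul, abs_mul, abs_of_nonneg hα, abs_of_nonneg hβ]
  have h2 : (α • s + β • w).re = α * s.re + β * w.re := by simp
  rw [h2]
  have h3 : α * (|s.im| * ‖v‖) + β * (|w.im| * ‖v‖) <
      α * (z.snd + s.re * v.snd) + β * (z.snd + w.re * v.snd) := by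
    rcases hα.eq_or_lt with rfl | hα
    · have : 0 < β := by linarith
      have := mul_lt_mul_of_pos_left hw this
      linarith
    · have := mul_lt_mul_of_pos_left hs hα
      have := mul_le_mul_of_nonneg_left hw.le hβ
      linarith
  calc _ ≤ (α * |s.im| + β * |w.im|) * ‖v‖ := mul_le_mul_of_nonneg_right h1 (norm_nonneg _)
    _ = α * (|s.im| * ‖v‖) + β * (|w.im| * ‖v‖) := by ring
    _ < _ := h3
    _ = (α + β) * z.snd + (α * s.re + β * w.re) * v.snd := by ring
    _ = _ := by rw [hαβ, one_mul]

lemma ofReal_mem_lineDomain {z v : PoissonSpace d} {s : ℝ} (h : 0 < (z + s • v).snd) :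
    (s : ℂ) ∈ lineDomain z v := by
  simpa [lineDomain] using h

lemma zero_mem_lineDomain {z : PoissonSpace d} (v : PoissonSpace d) (h : 0 < z.snd) :
    (0 : ℂ) ∈ lineDomain z v := by
  simpa [lineDomain] using h

lemma snd_sq_le_norm_sub_boundaryPoint_sq (z : PoissonSpace d) (u : EuclideanSpace ℝ (Fin d)) :
    z.snd ^ 2 ≤ ‖z - boundaryPoint u‖ ^ 2 := by
  rw [WithLp.prod_norm_sq_eq_of_L2]
  simp

lemma norm_add_smul_sub_boundaryPoint_sq (z v : PoissonSpace d) (u : EuclideanSpace ℝ (Fin d))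
    (s : ℝ) : ‖z + s • v - boundaryPoint u‖ ^ 2 = ‖z - boundaryPoint u‖ ^ 2 +
      2 * s * inner ℝ (z - boundaryPoint u) v + s ^ 2 * ‖v‖ ^ 2 := by
  rw [add_sub_right_comm, norm_add_sq_real, inner_smul_right, norm_smul, mul_pow,
    Real.norm_eq_abs, sq_abs]
  ring

lemma lineQuad_ofReal (z v : PoissonSpace d) (u : EuclideanSpace ℝ (Fin d)) (s : ℝ) :
    lineQuad z v u s = ((‖z + s • v - boundaryPoint u‖ ^ 2 : ℝ) : ℂ) := by
  rw [norm_add_smul_sub_boundaryPoint_sq, lineQuad]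
  push_cast
  ring

lemma lineProfile_ofReal (a : ℝ) (z v : PoissonSpace d) (u : EuclideanSpace ℝ (Fin d)) (s : ℝ) :
    lineProfile a z v s u = (poissonProfile a (z + s • v) u : ℂ) := by
  rw [lineProfile, lineQuad_ofReal, poissonProfile, ofReal_mul, ofReal_cpow (sq_nonneg _)]
  simp

/-- A lower bound for the real part of `lineQuad`, uniform in `u`. -/
lemma le_re_lineQuad (z v : PoissonSpace d) (u : EuclideanSpace ℝ (Fin d)) (s : ℂ) :
    (z.snd + s.re * v.snd) ^ 2 - (|s.im| * ‖v‖) ^ 2 ≤ (lineQuad z v u s).re := by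
  have h1 : (lineQuad z v u s).re =
      ‖z + s.re • v - boundaryPoint u‖ ^ 2 - (|s.im| * ‖v‖) ^ 2 := by
    rw [norm_add_smul_sub_boundaryPoint_sq, mul_pow, sq_abs, lineQuad]
    simp only [add_re, mul_re, mul_im, ofReal_re, ofReal_im, sq, re_ofNat, im_ofNat]
    ring
  have h2 := snd_sq_le_norm_sub_boundaryPoint_sq (z + s.re • v) u
  rw [h1]
  simpa using h2

lemma lineDomain_gap_pos {z v : PoissonSpace d} {s : ℂ} (hs : s ∈ lineDomain z v) :
    0 < (z.snd + s.re * v.snd) ^ 2 - (|s.im| * ‖v‖) ^ 2 := by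
  have h1 : |s.im| * ‖v‖ < z.snd + s.re * v.snd := hs
  have h2 : 0 ≤ |s.im| * ‖v‖ := by positivity
  nlinarith

lemma lineQuad_mem_slitPlane {z v : PoissonSpace d} {s : ℂ} (hs : s ∈ lineDomain z v)
    (u : EuclideanSpace ℝ (Fin d)) : lineQuad z v u s ∈ slitPlane :=
  Or.inl ((lineDomain_gap_pos hs).trans_le (le_re_lineQuad z v u s))

lemma hasDerivAt_lineQuad (z v : PoissonSpace d) (u : EuclideanSpace ℝ (Fin d)) (s : ℂ) :
    HasDerivAt (lineQuad z v u)
      (2 * ((inner ℝ (z - boundaryPoint u) v : ℝ) : ℂ) + 2 * s * ((‖v‖ ^ 2 : ℝ) : ℂ)) s := by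
  have h1 := ((((hasDerivAt_id s).const_mul 2).mul_const
    ((inner ℝ (z - boundaryPoint u) v : ℝ) : ℂ)).const_add
      ((‖z - boundaryPoint u‖ ^ 2 : ℝ) : ℂ)).add
        ((hasDerivAt_pow 2 s).mul_const ((‖v‖ ^ 2 : ℝ) : ℂ))
  exact h1.congr_deriv (by simp)

lemma hasDerivAt_snd_add_mul (z v : PoissonSpace d) (s : ℂ) :
    HasDerivAt (fun s : ℂ => (z.snd : ℂ) + s * v.snd) v.snd s := by
  simpa using ((hasDerivAt_id s).mul_const (v.snd : ℂ)).const_add (z.snd : ℂ)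

lemma hasDerivAt_lineProfile (a : ℝ) {z v : PoissonSpace d} {s : ℂ} (hs : s ∈ lineDomain z v)
    (u : EuclideanSpace ℝ (Fin d)) :
    HasDerivAt (fun s => lineProfile a z v s u)
      (v.snd * lineQuad z v u s ^ ((-a : ℝ) : ℂ) + ((z.snd : ℂ) + s * v.snd) *
        (((-a : ℝ) : ℂ) * lineQuad z v u s ^ (((-a : ℝ) : ℂ) - 1) *
          (2 * ((inner ℝ (z - boundaryPoint u) v : ℝ) : ℂ) + 2 * s * ((‖v‖ ^ 2 : ℝ) : ℂ)))) s :=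
  (hasDerivAt_snd_add_mul z v s).mul
    ((hasDerivAt_lineQuad z v u s).cpow_const (lineQuad_mem_slitPlane hs u))

lemma differentiableOn_lineProfile (a : ℝ) (z v : PoissonSpace d) (u : EuclideanSpace ℝ (Fin d)) :
    DifferentiableOn ℂ (fun s => lineProfile a z v s u) (lineDomain z v) := fun _ hs =>
  (hasDerivAt_lineProfile a hs u).differentiableAt.differentiableWithinAt

lemma measurable_lineProfile (a : ℝ) (z v : PoissonSpace d) (s : ℂ) :
    Measurable (lineProfile a z v s) := by
  have h : Continuous fun u => lineQuad z v u s := by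
    have := continuous_boundaryPoint (d := d)
    unfold lineQuad
    fun_prop
  exact (h.measurable.pow_const _).const_mul _

/-- Around each point of its domain, `lineProfile` is bounded uniformly in `u`. -/
lemma exists_ball_bound_lineProfile {a : ℝ} (ha : 0 ≤ a) {z v : PoissonSpace d} {s₀ : ℂ}
    (hs₀ : s₀ ∈ lineDomain z v) : ∃ R > 0, ∃ M, ball s₀ R ⊆ lineDomain z v ∧
      ∀ u, ∀ s ∈ ball s₀ R, ‖lineProfile a z v s u‖ ≤ M := by
  let B : ℂ → ℝ := fun s => ‖(z.snd : ℂ) + s * v.snd‖ *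
    ((z.snd + s.re * v.snd) ^ 2 - (|s.im| * ‖v‖) ^ 2) ^ (-a)
  have hB : ContinuousAt B s₀ := by
    refine ContinuousAt.mul (by fun_prop) (ContinuousAt.rpow_const ?_ ?_)
    · fun_prop
    · exact Or.inl (lineDomain_gap_pos hs₀).ne'
  have h1 : ∀ᶠ s in 𝓝 s₀, s ∈ lineDomain z v ∧ B s < B s₀ + 1 :=
    ((isOpen_lineDomain z v).eventually_mem hs₀).and (hB.eventually_lt_const (lt_add_one _))
  obtain ⟨R, hR, h⟩ := Metric.eventually_nhds_iff_ball.1 h1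
  refine ⟨R, hR, B s₀ + 1, fun s hs => (h s hs).1, fun u s hs => le_trans ?_ (h s hs).2.le⟩
  have hgap := lineDomain_gap_pos (h s hs).1
  rw [lineProfile, norm_mul, norm_cpow_real]
  refine mul_le_mul_of_nonneg_left ?_ (norm_nonneg _)
  exact Real.rpow_le_rpow_of_nonpos hgap ((le_re_lineQuad z v u s).trans (re_le_norm _))
    (neg_nonpos.2 ha)

lemma differentiableOn_integral_lineProfile (μ : Measure (EuclideanSpace ℝ (Fin d)))
    [IsFiniteMeasure μ] {a : ℝ} (ha : 0 ≤ a) (z v : PoissonSpace d) :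
    DifferentiableOn ℂ (fun s => ∫ u, lineProfile a z v s u ∂μ) (lineDomain z v) := by
  intro s hs
  obtain ⟨R, hR, M, hsub, hM⟩ := exists_ball_bound_lineProfile ha hs
  exact (hasDerivAt_integral_of_bounded_holomorphic hR
    (fun s _ => measurable_lineProfile a z v s)
    (fun u => (differentiableOn_lineProfile a z v u).mono hsub)
    hM).2.differentiableAt.differentiableWithinAt

lemma integral_lineProfile_ofReal (μ : Measure (EuclideanSpace ℝ (Fin d))) (a : ℝ)
    (z v : PoissonSpace d) (s : ℝ) :
    ∫ u, lineProfile a z v s u ∂μ = ((∫ u, poissonProfile a (z + s • v) u ∂μ : ℝ) : ℂ) := by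
  simp only [lineProfile_ofReal]
  exact integral_ofReal

/-- The second derivative of `lineProfile` at `0`, in terms of the boundary distance. -/
lemma deriv_deriv_lineProfile_zero (a : ℝ) {z : PoissonSpace d} (v : PoissonSpace d)
    (hz : 0 < z.snd) (u : EuclideanSpace ℝ (Fin d)) :
    deriv (deriv fun s => lineProfile a z v s u) 0 =
      ((‖z - boundaryPoint u‖ ^ 2 : ℝ) : ℂ) ^ (((-a : ℝ) : ℂ) - 1 - 1) *
        (((-a) * (4 * (v.snd * inner ℝ (z - boundaryPoint u) v) * ‖z - boundaryPoint u‖ ^ 2 +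
          z.snd * (4 * (-a - 1) * inner ℝ (z - boundaryPoint u) v ^ 2 +
            2 * ‖v‖ ^ 2 * ‖z - boundaryPoint u‖ ^ 2)) : ℝ) : ℂ) := by
  have h0 : (0 : ℂ) ∈ lineDomain z v := zero_mem_lineDomain v hz
  have hev := (isOpen_lineDomain z v).eventually_mem h0
  have h1 := EventuallyEq.deriv_eq (hev.mono fun s hs => (hasDerivAt_lineProfile a hs u).deriv)
  rw [h1]
  have hQ := lineQuad_mem_slitPlane h0 u
  have hQ' := hasDerivAt_lineQuad z v u 0
  have hlin : HasDerivAt (fun s : ℂ => 2 * ((inner ℝ (z - boundaryPoint u) v : ℝ) : ℂ) +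
      2 * s * ((‖v‖ ^ 2 : ℝ) : ℂ)) (2 * ((‖v‖ ^ 2 : ℝ) : ℂ)) 0 := by
    exact ((((hasDerivAt_id (0 : ℂ)).const_mul 2).mul_const
      ((‖v‖ ^ 2 : ℝ) : ℂ)).const_add (2 * ((inner ℝ (z - boundaryPoint u) v : ℝ) : ℂ))).congr_deriv
        (by rw [mul_one])
  have h2 := ((hQ'.cpow_const (c := ((-a : ℝ) : ℂ)) hQ).const_mul (v.snd : ℂ)).add
    ((hasDerivAt_snd_add_mul z v 0).mul
      (((hQ'.cpow_const (c := ((-a : ℝ) : ℂ) - 1) hQ).const_mul ((-a : ℝ) : ℂ)).mul hlin))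
  have hA : lineQuad z v u 0 = ((‖z - boundaryPoint u‖ ^ 2 : ℝ) : ℂ) := by simp [lineQuad]
  have hA0 : lineQuad z v u 0 ≠ 0 := slitPlane_ne_zero hQ
  refine h2.deriv.trans ?_
  have hpow : lineQuad z v u 0 ^ (((-a : ℝ) : ℂ) - 1) =
      lineQuad z v u 0 ^ (((-a : ℝ) : ℂ) - 1 - 1) * lineQuad z v u 0 := by
    rw [cpow_sub (((-a : ℝ) : ℂ) - 1) 1 hA0, cpow_one, div_mul_cancel₀ _ hA0]
  simp only [Pi.mul_apply]
  rw [hpow, ← hA]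
  push_cast
  have hA' : (‖z - boundaryPoint u‖ : ℂ) ^ 2 = lineQuad z v u 0 := by rw [hA]; push_cast; rfl
  rw [hA']
  ring

/-- The Poisson kernel is harmonic: the second derivatives along an orthonormal basis cancel. -/
lemma sum_deriv_deriv_lineProfile_zero {ι : Type*} [Fintype ι]
    (b : OrthonormalBasis ι ℝ (PoissonSpace d)) {z : PoissonSpace d} (hz : 0 < z.snd)
    (u : EuclideanSpace ℝ (Fin d)) :
    ∑ i, deriv (deriv fun s => lineProfile (((d : ℝ) + 1) / 2) z (b i) s u) 0 = 0 := by
  simp only [deriv_deriv_lineProfile_zero _ _ hz]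
  rw [← Finset.mul_sum, ← ofReal_sum]
  have hcard : (Fintype.card ι : ℝ) = d + 1 := by
    have h1 := Module.finrank_eq_card_basis b.toBasis
    rw [(WithLp.linearEquiv 2 ℝ (EuclideanSpace ℝ (Fin d) × ℝ)).finrank_eq,
      Module.finrank_prod, finrank_euclideanSpace_fin, Module.finrank_self] at h1
    exact_mod_cast h1.symm
  have hB : ∑ i, (b i).snd * inner ℝ (z - boundaryPoint u) (b i) = z.snd := by
    have h1 := b.sum_inner_mul_inner (z - boundaryPoint u) (WithLp.toLp 2 (0, 1))
    have h2 : ∀ y : PoissonSpace d, inner ℝ y (WithLp.toLp 2 (0, 1)) = y.snd := fun y => by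
      simp [WithLp.prod_inner_apply]
    simp only [h2] at h1
    simpa [mul_comm] using h1
  have hBB : ∑ i, inner ℝ (z - boundaryPoint u) (b i) ^ 2 = ‖z - boundaryPoint u‖ ^ 2 := by
    rw [← b.sum_sq_inner_left]
  rw [← Finset.mul_sum, Finset.sum_add_distrib, ← Finset.sum_mul, ← Finset.mul_sum,
    ← Finset.mul_sum, Finset.sum_add_distrib, ← Finset.mul_sum, hB, hBB]
  simp only [b.norm_eq_one, Finset.sum_const, nsmul_eq_mul, Finset.card_univ, hcard]
  -- the terms cancel because the dimension `d + 1` is twice the exponent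
  have : (4 * z.snd * ‖z - boundaryPoint u‖ ^ 2 + z.snd *
      (4 * (-(((d : ℝ) + 1) / 2) - 1) * ‖z - boundaryPoint u‖ ^ 2 +
        ((d : ℝ) + 1) * (2 * 1 ^ 2 * ‖z - boundaryPoint u‖ ^ 2))) = 0 := by ring
  rw [this]
  simp

/-- The Poisson transform of a finite measure, up to its constant, solves the Laplace equation in
the upper half-space. -/
lemma laplaceEquationAt_integral_poissonProfile (μ : Measure (EuclideanSpace ℝ (Fin d)))
    [IsFiniteMeasure μ] {ι : Type*} [Fintype ι] (b : OrthonormalBasis ι ℝ (PoissonSpace d))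
    {z : PoissonSpace d} (hz : 0 < z.snd) :
    LaplaceEquationAt b (fun z => ∫ u, poissonProfile (((d : ℝ) + 1) / 2) z u ∂μ) z := by
  set a : ℝ := ((d : ℝ) + 1) / 2 with ha
  have ha0 : 0 ≤ a := by positivity
  have hsecond : ∀ i, Integrable (fun u => deriv (deriv fun s => lineProfile a z (b i) s u) 0) μ ∧
      HasDerivAt (fun s => ∫ u, deriv (fun s => lineProfile a z (b i) s u) s ∂μ)
        (∫ u, deriv (deriv fun s => lineProfile a z (b i) s u) 0 ∂μ) 0 := by
    intro i
    obtain ⟨R, hR, M, hsub, hM⟩ :=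
      exists_ball_bound_lineProfile ha0 (zero_mem_lineDomain (b i) hz)
    exact hasDerivAt_deriv_integral_of_bounded_holomorphic hR
      (fun s _ => measurable_lineProfile a z (b i) s)
      (fun u => (differentiableOn_lineProfile a z (b i) u).mono hsub) hM
  refine ⟨fun i s => (∫ u, deriv (fun s => lineProfile a z (b i) s u) s ∂μ).re,
    fun i => (∫ u, deriv (deriv fun s => lineProfile a z (b i) s u) 0 ∂μ).re, ?_, fun i => ⟨?_, ?_⟩⟩
  · rw [← re_sum, ← integral_finsetSum _ fun i _ => (hsecond i).1]
    simp [ha, sum_deriv_deriv_lineProfile_zero b hz]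
  · have hev : ∀ᶠ s : ℝ in 𝓝 0, (s : ℂ) ∈ lineDomain z (b i) :=
      continuous_ofReal.continuousAt.eventually ((isOpen_lineDomain z (b i)).mem_nhds
        (by simpa using zero_mem_lineDomain (b i) hz))
    filter_upwards [hev] with s hs
    obtain ⟨R, hR, M, hsub, hM⟩ := exists_ball_bound_lineProfile ha0 hs
    have h1 := (hasDerivAt_integral_of_bounded_holomorphic (μ := μ) hR
      (fun s _ => measurable_lineProfile a z (b i) s)
      (fun u => (differentiableOn_lineProfile a z (b i) u).mono hsub) hM).2.real_of_complex
    simpa only [integral_lineProfile_ofReal, ofReal_re] using h1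
  · exact HasDerivAt.real_of_complex (z := 0) (by rw [ofReal_zero]; exact (hsecond i).2)

end

/-! ### Poisson transforms that agree on a sphere -/

section
open Filter Topology Metric

variable {d : ℕ}

lemma poissonProfile_nonneg (a : ℝ) {z : PoissonSpace d} (hz : 0 < z.snd)
    (u : EuclideanSpace ℝ (Fin d)) : 0 ≤ poissonProfile a z u :=
  mul_nonneg hz.le (Real.rpow_nonneg (sq_nonneg _) _)

lemma norm_sub_boundaryPoint_rpow_le {a : ℝ} (ha : 0 ≤ a) {z : PoissonSpace d} (hz : 0 < z.snd)
    (u : EuclideanSpace ℝ (Fin d)) :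
    (‖z - boundaryPoint u‖ ^ 2) ^ (-a) ≤ (z.snd ^ 2) ^ (-a) :=
  Real.rpow_le_rpow_of_nonpos (by positivity) (snd_sq_le_norm_sub_boundaryPoint_sq z u)
    (neg_nonpos.2 ha)

lemma poissonProfile_le {a : ℝ} (ha : 0 ≤ a) {z : PoissonSpace d} (hz : 0 < z.snd)
    (u : EuclideanSpace ℝ (Fin d)) : poissonProfile a z u ≤ z.snd * (z.snd ^ 2) ^ (-a) :=
  mul_le_mul_of_nonneg_left (norm_sub_boundaryPoint_rpow_le ha hz u) hz.le

lemma le_norm_sub_boundaryPoint {z : PoissonSpace d} (hz : 0 < z.snd)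
    (u : EuclideanSpace ℝ (Fin d)) : z.snd ≤ ‖z - boundaryPoint u‖ :=
  (pow_le_pow_iff_left₀ hz.le (norm_nonneg _) two_ne_zero).1
    (snd_sq_le_norm_sub_boundaryPoint_sq z u)

lemma continuous_snd_poissonSpace : Continuous fun z : PoissonSpace d => z.snd :=
  (WithLp.sndL 2 ℝ (EuclideanSpace ℝ (Fin d)) ℝ).continuous

lemma continuous_poissonProfile (a : ℝ) {z : PoissonSpace d} (hz : 0 < z.snd) :
    Continuous (poissonProfile a z) := by
  refine continuous_const.mul (Continuous.rpow_const ?_ fun u => Or.inl ?_)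
  · exact (continuous_const.sub continuous_boundaryPoint).norm.pow 2
  · have := hz.trans_le (le_norm_sub_boundaryPoint hz u)
    positivity

/-- The Poisson kernel depends continuously on the point of the half-space, uniformly in the pole:
the ratio of the distances of two points from a pole tends to `1` uniformly. -/
lemma eventually_abs_poissonProfile_sub_le {a : ℝ} (ha : 0 ≤ a) {z₀ : PoissonSpace d}
    (hz₀ : 0 < z₀.snd) {ε : ℝ} (hε : 0 < ε) :
    ∀ᶠ z in 𝓝 z₀, ∀ u, |poissonProfile a z u - poissonProfile a z₀ u| ≤ ε := by
  -- `g` is evaluated at the height of `z` and the ratio of the distances of `z`, `z₀` from `u`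
  let g : ℝ × ℝ → ℝ := fun p => p.1 * (p.2 ^ 2) ^ (-a) - z₀.snd
  have hg : ContinuousAt g (z₀.snd, 1) := by
    refine ContinuousAt.sub (ContinuousAt.mul (by fun_prop) (ContinuousAt.rpow_const ?_ ?_))
      continuousAt_const
    · fun_prop
    · simp
  have hg0 : g (z₀.snd, 1) = 0 := by simp [g]
  set C := (z₀.snd ^ 2) ^ (-a) with hC
  have hCpos : 0 < C := Real.rpow_pos_of_pos (by positivity) _
  obtain ⟨η, hη, h⟩ := Metric.continuousAt_iff.1 hg (ε / C) (by positivity)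
  have h1 : ∀ᶠ z : PoissonSpace d in 𝓝 z₀, dist z.snd z₀.snd < η :=
    continuous_snd_poissonSpace.continuousAt.eventually (ball_mem_nhds _ hη)
  have h2 : ∀ᶠ z : PoissonSpace d in 𝓝 z₀, ‖z - z₀‖ < η * z₀.snd := by
    have : ∀ᶠ z : PoissonSpace d in 𝓝 z₀, dist z z₀ < η * z₀.snd :=
      ball_mem_nhds _ (by positivity)
    simpa only [dist_eq_norm] using this
  filter_upwards [h1, h2] with z hz1 hz2 u
  set ρ := ‖z₀ - boundaryPoint u‖ with hρ
  have hρz : z₀.snd ≤ ρ := le_norm_sub_boundaryPoint hz₀ u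
  have hρ0 : 0 < ρ := hz₀.trans_le hρz
  have hratio : dist (‖z - boundaryPoint u‖ / ρ) 1 < η := by
    rw [Real.dist_eq, div_sub_one hρ0.ne', abs_div, abs_of_pos hρ0, div_lt_iff₀ hρ0]
    have h3 : |‖z - boundaryPoint u‖ - ρ| ≤ ‖z - z₀‖ := by
      have := abs_norm_sub_norm_le (z - boundaryPoint u) (z₀ - boundaryPoint u)
      rwa [sub_sub_sub_cancel_right] at this
    exact (h3.trans_lt hz2).trans_le (mul_le_mul_of_nonneg_left hρz hη.le)
  have h4 := h (x := (z.snd, ‖z - boundaryPoint u‖ / ρ)) (by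
    rw [Prod.dist_eq]; exact max_lt hz1 hratio)
  rw [hg0, dist_zero_right, Real.norm_eq_abs] at h4
  have h5 : poissonProfile a z u - poissonProfile a z₀ u =
      (ρ ^ 2) ^ (-a) * g (z.snd, ‖z - boundaryPoint u‖ / ρ) := by
    have h6 : (‖z - boundaryPoint u‖ ^ 2) ^ (-a) =
        (ρ ^ 2) ^ (-a) * ((‖z - boundaryPoint u‖ / ρ) ^ 2) ^ (-a) := by
      rw [← Real.mul_rpow (by positivity) (by positivity), ← mul_pow, mul_div_cancel₀ _ hρ0.ne']
    simp only [poissonProfile, g, h6, ← hρ]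
    ring
  rw [h5, abs_mul, abs_of_nonneg (Real.rpow_nonneg (sq_nonneg _) _)]
  calc _ ≤ C * (ε / C) := mul_le_mul (norm_sub_boundaryPoint_rpow_le ha hz₀ u) h4.le
        (abs_nonneg _) hCpos.le
    _ = ε := by field_simp

section Integral

variable (μ ν : Measure (EuclideanSpace ℝ (Fin d))) [IsFiniteMeasure μ] [IsFiniteMeasure ν]

lemma integrable_poissonProfile {a : ℝ} (ha : 0 ≤ a) {z : PoissonSpace d} (hz : 0 < z.snd) :
    Integrable (poissonProfile a z) μ :=
  Integrable.of_bound (continuous_poissonProfile a hz).aestronglyMeasurable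
    (z.snd * (z.snd ^ 2) ^ (-a)) (Eventually.of_forall fun u => by
      rw [Real.norm_of_nonneg (poissonProfile_nonneg a hz u)]
      exact poissonProfile_le ha hz u)

lemma continuousAt_integral_poissonProfile {a : ℝ} (ha : 0 ≤ a) {z₀ : PoissonSpace d}
    (hz₀ : 0 < z₀.snd) : ContinuousAt (fun z => ∫ u, poissonProfile a z u ∂μ) z₀ := by
  rw [Metric.continuousAt_iff']
  intro ε hε
  have hM : 0 < μ.real Set.univ + 1 := by positivity
  have hδ : 0 < ε / (μ.real Set.univ + 1) := by positivity
  filter_upwards [eventually_abs_poissonProfile_sub_le ha hz₀ hδ,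
    continuous_snd_poissonSpace.continuousAt.eventually_const_lt hz₀] with z hz hz0
  rw [dist_eq_norm, ← integral_sub (integrable_poissonProfile μ ha hz0)
    (integrable_poissonProfile μ ha hz₀)]
  refine (norm_integral_le_of_norm_le_const (Eventually.of_forall hz)).trans_lt ?_
  rw [div_mul_eq_mul_div, div_lt_iff₀ hM]
  exact mul_lt_mul_of_pos_left (lt_add_one _) hε

variable {μ ν}

lemma LaplaceEquationAt.sub {V ι : Type*} [NormedAddCommGroup V] [InnerProductSpace ℝ V]
    [Fintype ι] {b : OrthonormalBasis ι ℝ V} {f g : V → ℝ} {z : V}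
    (hf : LaplaceEquationAt b f z) (hg : LaplaceEquationAt b g z) :
    LaplaceEquationAt b (fun z => f z - g z) z := by
  obtain ⟨φ, D, hD, hφ⟩ := hf
  obtain ⟨ψ, D', hD', hψ⟩ := hg
  refine ⟨fun i s => φ i s - ψ i s, fun i => D i - D' i, ?_, fun i => ⟨?_, ?_⟩⟩
  · rw [Finset.sum_sub_distrib, hD, hD', sub_zero]
  · filter_upwards [(hφ i).1, (hψ i).1] with s h1 h2 using h1.sub h2
  · exact (hφ i).2.sub (hψ i).2

/-- The Poisson kernel as a multiple of its profile. -/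
lemma poissonKernelHalfSpace_eq (z : PoissonSpace d) (u : EuclideanSpace ℝ (Fin d)) :
    poissonKernelHalfSpace (z.fst - u) z.snd =
      Real.Gamma (((d : ℝ) + 1) / 2) / Real.pi ^ (((d : ℝ) + 1) / 2) *
        poissonProfile (((d : ℝ) + 1) / 2) z u := by
  have h : z.snd ^ 2 + ‖z.fst - u‖ ^ 2 = ‖z - boundaryPoint u‖ ^ 2 := by
    rw [WithLp.prod_norm_sq_eq_of_L2, add_comm]
    simp
  rw [poissonKernelHalfSpace, poissonProfile, h, Real.rpow_neg (sq_nonneg _), div_eq_mul_inv z.snd]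

lemma poissonConstant_pos (d : ℕ) :
    0 < Real.Gamma (((d : ℝ) + 1) / 2) / Real.pi ^ (((d : ℝ) + 1) / 2) :=
  div_pos (Real.Gamma_pos_of_pos (by positivity)) (Real.rpow_pos_of_pos Real.pi_pos _)

lemma poissonExponent_nonneg (d : ℕ) : 0 ≤ ((d : ℝ) + 1) / 2 := by positivity

lemma snd_pos_of_mem_closedBall {c z : PoissonSpace d} {r : ℝ} (hr : r < c.snd)
    (hz : z ∈ closedBall c r) : 0 < z.snd := by
  have h1 : ‖(z - c).snd‖ ≤ ‖z - c‖ := by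
    have h := WithLp.prod_norm_sq_eq_of_L2 (z - c)
    refine (pow_le_pow_iff_left₀ (norm_nonneg _) (norm_nonneg _) two_ne_zero).1 ?_
    nlinarith [sq_nonneg ‖(z - c).fst‖]
  rw [mem_closedBall, dist_eq_norm] at hz
  have h2 := neg_abs_le (z - c).snd
  rw [← Real.norm_eq_abs] at h2
  simp only [WithLp.sub_snd] at h1 h2
  linarith

lemma integral_poissonProfile_le_on_ball {c : PoissonSpace d} {r : ℝ} (hr : r < c.snd)
    (hs : ∀ z ∈ sphere c r, ∫ u, poissonProfile (((d : ℝ) + 1) / 2) z u ∂μ =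
      ∫ u, poissonProfile (((d : ℝ) + 1) / 2) z u ∂ν) {z : PoissonSpace d} (hz : z ∈ ball c r) :
    ∫ u, poissonProfile (((d : ℝ) + 1) / 2) z u ∂μ ≤
      ∫ u, poissonProfile (((d : ℝ) + 1) / 2) z u ∂ν := by
  have hpos : ∀ z ∈ closedBall c r, 0 < z.snd := fun z => snd_pos_of_mem_closedBall hr
  let b := stdOrthonormalBasis ℝ (PoissonSpace d)
  have hne : Nonempty (Fin (Module.finrank ℝ (PoissonSpace d))) := by
    have : Nontrivial (PoissonSpace d) :=
      (WithLp.equiv 2 (EuclideanSpace ℝ (Fin d) × ℝ)).nontrivial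
    exact Fin.pos_iff_nonempty.1 Module.finrank_pos
  rw [← sub_nonpos]
  refine nonpos_on_ball_of_laplaceEquationAt b (h := fun z =>
    ∫ u, poissonProfile (((d : ℝ) + 1) / 2) z u ∂μ - ∫ u, poissonProfile (((d : ℝ) + 1) / 2) z u ∂ν)
    ?_ (fun z hz => ?_) (fun z hz => (sub_eq_zero.2 (hs z hz)).le) z hz
  · intro z hz
    exact ((continuousAt_integral_poissonProfile μ (poissonExponent_nonneg d) (hpos z hz)).sub
      (continuousAt_integral_poissonProfile ν (poissonExponent_nonneg d)
        (hpos z hz))).continuousWithinAt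
  · have hz' := hpos z (ball_subset_closedBall hz)
    exact (laplaceEquationAt_integral_poissonProfile μ b hz').sub
      (laplaceEquationAt_integral_poissonProfile ν b hz')

/-- Two Poisson transforms which agree on a sphere in the half-space agree everywhere: they agree
in the ball by the maximum principle, and along segments from its centre by the identity theorem
for holomorphic functions. -/
lemma integral_poissonProfile_eq_of_eq_on_sphere {c : PoissonSpace d} {r : ℝ} (hr0 : 0 < r)
    (hr : r < c.snd) (hs : ∀ z ∈ sphere c r, ∫ u, poissonProfile (((d : ℝ) + 1) / 2) z u ∂μ =
      ∫ u, poissonProfile (((d : ℝ) + 1) / 2) z u ∂ν) {z : PoissonSpace d} (hz : 0 < z.snd) :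
    ∫ u, poissonProfile (((d : ℝ) + 1) / 2) z u ∂μ =
      ∫ u, poissonProfile (((d : ℝ) + 1) / 2) z u ∂ν := by
  have hball : ∀ y ∈ ball c r, ∫ u, poissonProfile (((d : ℝ) + 1) / 2) y u ∂μ =
      ∫ u, poissonProfile (((d : ℝ) + 1) / 2) y u ∂ν := fun y hy =>
    (integral_poissonProfile_le_on_ball hr hs hy).antisymm
      (integral_poissonProfile_le_on_ball hr (fun y hy => (hs y hy).symm) hy)
  have hc : 0 < c.snd := hr0.trans hr
  set a := ((d : ℝ) + 1) / 2
  let v := z - c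
  let G : ℂ → ℂ := fun s => ∫ u, lineProfile a c v s u ∂μ - ∫ u, lineProfile a c v s u ∂ν
  have hG : DifferentiableOn ℂ G (lineDomain c v) :=
    (differentiableOn_integral_lineProfile μ (poissonExponent_nonneg d) c v).sub
      (differentiableOn_integral_lineProfile ν (poissonExponent_nonneg d) c v)
  have hGreal : ∀ s : ℝ, G s = ((∫ u, poissonProfile a (c + s • v) u ∂μ -
      ∫ u, poissonProfile a (c + s • v) u ∂ν : ℝ) : ℂ) := fun s => by
    simp only [G, integral_lineProfile_ofReal, Complex.ofReal_sub]
  -- `c + s v` lies in the ball for small real `s`, so the zeros of `G` accumulate at `0`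
  have hfreq : ∃ᶠ s in 𝓝[≠] (0 : ℂ), G s = 0 := by
    have hlim : Tendsto (fun n : ℕ => (1 : ℝ) / (n + 1)) atTop (𝓝 0) :=
      tendsto_one_div_add_atTop_nhds_zero_nat
    have hC : Tendsto (fun n : ℕ => (((1 : ℝ) / (n + 1) : ℝ) : ℂ)) atTop (𝓝[≠] 0) := by
      refine tendsto_nhdsWithin_iff.2 ⟨?_, Eventually.of_forall fun n => ?_⟩
      · exact (Complex.continuous_ofReal.tendsto' 0 0 Complex.ofReal_zero).comp hlim
      · rw [Set.mem_compl_iff, Set.mem_singleton_iff, Complex.ofReal_eq_zero]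
        positivity
    have hev : ∀ᶠ n : ℕ in atTop, c + ((1 : ℝ) / (n + 1)) • v ∈ ball c r := by
      have h1 : Tendsto (fun n : ℕ => c + ((1 : ℝ) / (n + 1)) • v) atTop (𝓝 (c + (0 : ℝ) • v)) :=
        (hlim.smul_const v).const_add c
      rw [zero_smul, add_zero] at h1
      exact h1.eventually (ball_mem_nhds c hr0)
    refine hC.frequently (hev.mono fun n hn => ?_).frequently
    rw [hGreal, hball _ hn, sub_self, Complex.ofReal_zero]
  have han := hG.analyticOnNhd (isOpen_lineDomain c v)
  have hzero := han.eqOn_zero_of_preconnected_of_frequently_eq_zero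
    (convex_lineDomain c v).isPreconnected (zero_mem_lineDomain v hc) hfreq
  have h1 : ((1 : ℝ) : ℂ) ∈ lineDomain c v := ofReal_mem_lineDomain (by simpa [v] using hz)
  have h2 := hzero h1
  rw [hGreal, one_smul, add_sub_cancel] at h2
  exact sub_eq_zero.1 (Complex.ofReal_eq_zero.1 h2)

end Integral

end

/-! ### A finite measure is determined by its Poisson transform -/

section
open Filter Topology Metric

variable {d : ℕ}

/-- The Poisson kernel at height `1`, normalized to have integral `1`. -/
noncomputable def poissonBump (d : ℕ) (x : EuclideanSpace ℝ (Fin d)) : ℝ :=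
  (∫ y : EuclideanSpace ℝ (Fin d), (1 + ‖y‖ ^ 2) ^ (-((d : ℝ) + 1) / 2))⁻¹ *
    (1 + ‖x‖ ^ 2) ^ (-((d : ℝ) + 1) / 2)

lemma integrable_one_add_norm_sq_rpow (d : ℕ) :
    Integrable fun y : EuclideanSpace ℝ (Fin d) => (1 + ‖y‖ ^ 2) ^ (-((d : ℝ) + 1) / 2) :=
  integrable_rpow_neg_one_add_norm_sq (by simp)

lemma continuous_one_add_norm_sq_rpow (d : ℕ) :
    Continuous fun y : EuclideanSpace ℝ (Fin d) => (1 + ‖y‖ ^ 2) ^ (-((d : ℝ) + 1) / 2) :=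
  Continuous.rpow_const (by fun_prop) fun y => Or.inl (by positivity)

lemma integral_one_add_norm_sq_rpow_pos (d : ℕ) :
    0 < ∫ y : EuclideanSpace ℝ (Fin d), (1 + ‖y‖ ^ 2) ^ (-((d : ℝ) + 1) / 2) :=
  integral_pos_of_integrable_nonneg_nonzero (continuous_one_add_norm_sq_rpow d)
    (integrable_one_add_norm_sq_rpow d) (fun y => by positivity) (x := 0) (by simp)

lemma poissonBump_nonneg (x : EuclideanSpace ℝ (Fin d)) : 0 ≤ poissonBump d x :=
  mul_nonneg (inv_nonneg.2 (integral_one_add_norm_sq_rpow_pos d).le) (by positivity)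

lemma continuous_poissonBump (d : ℕ) : Continuous (poissonBump d) :=
  continuous_const.mul (continuous_one_add_norm_sq_rpow d)

lemma integral_poissonBump (d : ℕ) : ∫ x, poissonBump d x = 1 := by
  unfold poissonBump
  rw [integral_const_mul, inv_mul_cancel₀ (integral_one_add_norm_sq_rpow_pos d).ne']

lemma tendsto_norm_pow_mul_poissonBump (d : ℕ) :
    Tendsto (fun x => ‖x‖ ^ d * poissonBump d x) (Bornology.cobounded _) (𝓝 0) := by
  set I := ∫ y : EuclideanSpace ℝ (Fin d), (1 + ‖y‖ ^ 2) ^ (-((d : ℝ) + 1) / 2) with hI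
  have hIpos : 0 < I := integral_one_add_norm_sq_rpow_pos d
  clear_value I
  have hlim : Tendsto (fun x : EuclideanSpace ℝ (Fin d) => I⁻¹ * ‖x‖⁻¹) (Bornology.cobounded _)
      (𝓝 0) := by
    simpa using (tendsto_inv_atTop_zero.comp tendsto_norm_cobounded_atTop).const_mul I⁻¹
  have hev : ∀ᶠ x : EuclideanSpace ℝ (Fin d) in Bornology.cobounded _, 0 < ‖x‖ :=
    tendsto_norm_cobounded_atTop.eventually_gt_atTop 0
  refine squeeze_zero' (Eventually.of_forall fun x =>
    mul_nonneg (by positivity) (poissonBump_nonneg x)) (hev.mono fun x hx => ?_) hlim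
  have h1 : (1 + ‖x‖ ^ 2) ^ (-((d : ℝ) + 1) / 2) ≤ (‖x‖ ^ (d + 1))⁻¹ := by
    have h2 : (‖x‖ ^ (d + 1))⁻¹ = (‖x‖ ^ 2) ^ (-((d : ℝ) + 1) / 2) := by
      rw [← Real.rpow_natCast ‖x‖ 2, ← Real.rpow_mul hx.le, ← Real.rpow_natCast,
        ← Real.rpow_neg hx.le]
      congr 1
      push_cast
      ring
    rw [h2]
    exact Real.rpow_le_rpow_of_nonpos (by positivity) (by linarith)
      (by have : (0 : ℝ) ≤ d := d.cast_nonneg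
          linarith)
  calc ‖x‖ ^ d * poissonBump d x = I⁻¹ * (‖x‖ ^ d * (1 + ‖x‖ ^ 2) ^ (-((d : ℝ) + 1) / 2)) := by
        rw [poissonBump, ← hI]; ring
    _ ≤ I⁻¹ * (‖x‖ ^ d * (‖x‖ ^ (d + 1))⁻¹) := by gcongr
    _ = I⁻¹ * ‖x‖⁻¹ := by rw [pow_succ]; field_simp

/-- The rescaled bump is the Poisson kernel at height `1 / c`, up to a constant. -/
lemma scaled_poissonBump_eq {c : ℝ} (hc : 0 < c) (x u : EuclideanSpace ℝ (Fin d)) :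
    c ^ d * poissonBump d (c • (u - x)) =
      (∫ y : EuclideanSpace ℝ (Fin d), (1 + ‖y‖ ^ 2) ^ (-((d : ℝ) + 1) / 2))⁻¹ *
        poissonProfile (((d : ℝ) + 1) / 2) (WithLp.toLp 2 (x, c⁻¹)) u := by
  have h1 : ‖(WithLp.toLp 2 (x, c⁻¹) : PoissonSpace d) - boundaryPoint u‖ ^ 2 =
      (c ^ 2)⁻¹ * (1 + ‖c • (u - x)‖ ^ 2) := by
    rw [WithLp.prod_norm_sq_eq_of_L2]
    simp only [WithLp.sub_fst, WithLp.sub_snd, fst_boundaryPoint, snd_boundaryPoint, sub_zero,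
      norm_smul, Real.norm_eq_abs, abs_of_pos hc, mul_pow, sq_abs, norm_sub_rev u x]
    change ‖x - u‖ ^ 2 + c⁻¹ ^ 2 = _
    field_simp
    ring
  have h2 : ((c ^ 2)⁻¹) ^ (-(((d : ℝ) + 1) / 2)) = c ^ (d + 1) := by
    rw [Real.inv_rpow (by positivity), Real.rpow_neg (by positivity), inv_inv,
      ← Real.rpow_natCast c 2, ← Real.rpow_mul hc.le, ← Real.rpow_natCast]
    congr 1
    push_cast
    ring
  rw [poissonProfile, h1, Real.mul_rpow (by positivity) (by positivity), h2, poissonBump, neg_div]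
  change _ = _ * (c⁻¹ * _)
  field_simp
  ring

lemma integral_scaled_poissonBump {c : ℝ} (hc : 0 < c) (u : EuclideanSpace ℝ (Fin d)) :
    ∫ x, c ^ d * poissonBump d (c • (u - x)) = 1 := by
  rw [integral_const_mul, integral_sub_left_eq_self (fun x => poissonBump d (c • x)) volume u,
    Measure.integral_comp_smul, integral_poissonBump, finrank_euclideanSpace_fin, smul_eq_mul,
    mul_one, abs_of_pos (by positivity)]
  exact mul_inv_cancel₀ (by positivity)

lemma integrable_scaled_poissonBump {c : ℝ} (hc : 0 < c) (u : EuclideanSpace ℝ (Fin d)) :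
    Integrable fun x => c ^ d * poissonBump d (c • (u - x)) :=
  Integrable.of_integral_ne_zero (by rw [integral_scaled_poissonBump hc]; exact one_ne_zero)

section Integral

variable (μ : Measure (EuclideanSpace ℝ (Fin d))) [IsFiniteMeasure μ]

lemma continuous_scaled_poissonBump (c : ℝ) :
    Continuous fun p : EuclideanSpace ℝ (Fin d) × EuclideanSpace ℝ (Fin d) =>
      c ^ d * poissonBump d (c • (p.1 - p.2)) := by
  have := continuous_poissonBump d
  fun_prop

/-- The Poisson kernels form an approximate identity, tested against a finite measure. -/
lemma tendsto_integral_scaled_poissonBump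
    (g : CompactlySupportedContinuousMap (EuclideanSpace ℝ (Fin d)) ℝ) :
    Tendsto (fun c : ℝ => ∫ u, (∫ x, c ^ d * poissonBump d (c • (u - x)) * g x) ∂μ) atTop
      (𝓝 (∫ u, g u ∂μ)) := by
  obtain ⟨M, hM⟩ := g.hasCompactSupport.exists_bound_of_continuous g.continuous
  refine tendsto_integral_filter_of_dominated_convergence (fun _ => M) ?_ ?_
    (integrable_const M) (Eventually.of_forall fun u => ?_)
  · refine Eventually.of_forall fun c => StronglyMeasurable.aestronglyMeasurable ?_
    exact (((continuous_scaled_poissonBump c).mul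
      (g.continuous.comp continuous_snd)).stronglyMeasurable).integral_prod_right
  · filter_upwards [eventually_gt_atTop 0] with c hc
    refine Eventually.of_forall fun u => ?_
    have h1 := norm_integral_le_of_norm_le
      (f := fun x => c ^ d * poissonBump d (c • (u - x)) * g x)
      ((integrable_scaled_poissonBump hc u).mul_const M) (Eventually.of_forall fun x => by
        rw [norm_mul, Real.norm_of_nonneg (mul_nonneg (by positivity) (poissonBump_nonneg _))]
        exact mul_le_mul_of_nonneg_left (hM x)
          (mul_nonneg (by positivity) (poissonBump_nonneg _)))
    rwa [integral_mul_const, integral_scaled_poissonBump hc, one_mul] at h1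
  · have h1 := tendsto_integral_comp_smul_smul_of_integrable' (μ := volume) (φ := poissonBump d)
      poissonBump_nonneg (integral_poissonBump d)
      (by simpa using tendsto_norm_pow_mul_poissonBump d)
      (g := g) (x₀ := u) (g.continuous.integrable_of_hasCompactSupport g.hasCompactSupport)
      g.continuous.continuousAt
    simpa using h1

lemma integral_scaled_poissonBump_swap {c : ℝ} (hc : 0 < c)
    (g : CompactlySupportedContinuousMap (EuclideanSpace ℝ (Fin d)) ℝ) :
    ∫ u, (∫ x, c ^ d * poissonBump d (c • (u - x)) * g x) ∂μ =
      ∫ x, (∫ y : EuclideanSpace ℝ (Fin d), (1 + ‖y‖ ^ 2) ^ (-((d : ℝ) + 1) / 2))⁻¹ *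
        (∫ u, poissonProfile (((d : ℝ) + 1) / 2) (WithLp.toLp 2 (x, c⁻¹)) u ∂μ) * g x := by
  set I := ∫ y : EuclideanSpace ℝ (Fin d), (1 + ‖y‖ ^ 2) ^ (-((d : ℝ) + 1) / 2) with hI
  have hIpos : 0 < I := integral_one_add_norm_sq_rpow_pos d
  rw [integral_integral_swap]
  · refine integral_congr_ae (Eventually.of_forall fun x => ?_)
    simp only [scaled_poissonBump_eq hc]
    rw [integral_mul_const, integral_const_mul]
  · have h1 : Integrable (fun p : EuclideanSpace ℝ (Fin d) × EuclideanSpace ℝ (Fin d) => g p.2)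
        (μ.prod volume) :=
      (g.continuous.integrable_of_hasCompactSupport g.hasCompactSupport).comp_snd μ
    refine h1.bdd_mul (c := I⁻¹ * (c⁻¹ * ((c⁻¹) ^ 2) ^ (-(((d : ℝ) + 1) / 2))))
      (continuous_scaled_poissonBump c).aestronglyMeasurable (Eventually.of_forall fun p => ?_)
    rw [Real.norm_of_nonneg (mul_nonneg (by positivity) (poissonBump_nonneg _)),
      scaled_poissonBump_eq hc]
    exact mul_le_mul_of_nonneg_left (poissonProfile_le (z := WithLp.toLp 2 (p.2, c⁻¹))
      (poissonExponent_nonneg d) (inv_pos.2 hc) p.1) (inv_nonneg.2 hIpos.le)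

/-- A finite measure is determined by its Poisson transform. -/
lemma measure_eq_of_integral_poissonProfile_eq (ν : Measure (EuclideanSpace ℝ (Fin d)))
    [IsFiniteMeasure ν] (h : ∀ z : PoissonSpace d, 0 < z.snd →
      ∫ u, poissonProfile (((d : ℝ) + 1) / 2) z u ∂μ =
        ∫ u, poissonProfile (((d : ℝ) + 1) / 2) z u ∂ν) : μ = ν := by
  refine Measure.ext_of_integral_eq_on_compactlySupported fun g => ?_
  refine tendsto_nhds_unique_of_eventuallyEq (tendsto_integral_scaled_poissonBump μ g)
    (tendsto_integral_scaled_poissonBump ν g) ?_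
  filter_upwards [eventually_gt_atTop 0] with c hc
  rw [integral_scaled_poissonBump_swap μ hc, integral_scaled_poissonBump_swap ν hc]
  refine integral_congr_ae (Eventually.of_forall fun x => ?_)
  simp only [h (WithLp.toLp 2 (x, c⁻¹)) (inv_pos.2 hc)]

end Integral

end

/-! ### The Poisson gap -/

section
open Filter Topology Metric

variable {d : ℕ} {μ ν : Measure (EuclideanSpace ℝ (Fin d))}

/-- `(p, q)` encloses the Poisson kernel at `(x, t)`: `p(u) ≤ P(x - u, t) ≤ q(u)` for all `u`. -/
def EnclosesPoissonKernel (x : EuclideanSpace ℝ (Fin d)) (t : ℝ)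
    (p q : MvPolynomial (Fin d) ℝ) : Prop :=
  ∀ u : EuclideanSpace ℝ (Fin d), MvPolynomial.eval u.ofLp p ≤ poissonKernelHalfSpace (x - u) t ∧
    poissonKernelHalfSpace (x - u) t ≤ MvPolynomial.eval u.ofLp q

lemma poissonGap_le (hμ : Admissible μ) {x : EuclideanSpace ℝ (Fin d)} {t : ℝ}
    {p q : MvPolynomial (Fin d) ℝ} (h : EnclosesPoissonKernel x t p q) :
    poissonGap μ x t ≤ ∫ u, MvPolynomial.eval u.ofLp q ∂μ - ∫ u, MvPolynomial.eval u.ofLp p ∂μ := by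
  rw [← integral_sub (hμ.2 q) (hμ.2 p)]
  refine csInf_le ⟨0, ?_⟩ ⟨p, q, h, rfl⟩
  rintro _ ⟨p, q, h, rfl⟩
  exact integral_nonneg fun u => sub_nonneg.2 ((h u).1.trans (h u).2)

lemma continuous_poissonKernelHalfSpace {z : PoissonSpace d} (hz : 0 < z.snd) :
    Continuous fun u => poissonKernelHalfSpace (z.fst - u) z.snd := by
  simp only [poissonKernelHalfSpace_eq]
  exact continuous_const.mul (continuous_poissonProfile _ hz)

lemma exists_bound_poissonKernelHalfSpace {z : PoissonSpace d} (hz : 0 < z.snd) :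
    ∃ M, ∀ u, 0 ≤ poissonKernelHalfSpace (z.fst - u) z.snd ∧
      poissonKernelHalfSpace (z.fst - u) z.snd ≤ M := by
  simp only [poissonKernelHalfSpace_eq]
  exact ⟨_, fun u => ⟨mul_nonneg (poissonConstant_pos d).le (poissonProfile_nonneg _ hz u),
    mul_le_mul_of_nonneg_left (poissonProfile_le (poissonExponent_nonneg d) hz u)
      (poissonConstant_pos d).le⟩⟩

lemma le_poissonGap (hμ : Admissible μ) {z : PoissonSpace d} (hz : 0 < z.snd) {a : ℝ}
    (h : ∀ p q, EnclosesPoissonKernel z.fst z.snd p q →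
      a ≤ ∫ u, MvPolynomial.eval u.ofLp q ∂μ - ∫ u, MvPolynomial.eval u.ofLp p ∂μ) :
    a ≤ poissonGap μ z.fst z.snd := by
  obtain ⟨M, hM⟩ := exists_bound_poissonKernelHalfSpace hz
  refine le_csInf ⟨_, 0, MvPolynomial.C M, fun u => by simpa using hM u, rfl⟩ ?_
  rintro _ ⟨p, q, hpq, rfl⟩
  rw [integral_sub (hμ.2 q) (hμ.2 p)]
  exact h p q hpq

lemma poissonGap_nonneg (hμ : Admissible μ) {z : PoissonSpace d} (hz : 0 < z.snd) :
    0 ≤ poissonGap μ z.fst z.snd :=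
  le_poissonGap hμ hz fun p q h => sub_nonneg.2 <|
    integral_mono (hμ.2 p) (hμ.2 q) fun u => (h u).1.trans (h u).2

lemma integrable_poissonKernelHalfSpace [IsFiniteMeasure μ] {z : PoissonSpace d}
    (hz : 0 < z.snd) : Integrable (fun u => poissonKernelHalfSpace (z.fst - u) z.snd) μ := by
  simp only [poissonKernelHalfSpace_eq]
  exact (integrable_poissonProfile μ (poissonExponent_nonneg d) hz).const_mul _

/-- Enclosing polynomials have the same integrals against moment equivalent measures, so the gap
bounds the difference of the Poisson transforms. -/
lemma integral_poissonKernelHalfSpace_sub_le_poissonGap (hμ : Admissible μ) (hν : Admissible ν)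
    (h : MomentEquivalent μ ν) {z : PoissonSpace d} (hz : 0 < z.snd) :
    |∫ u, poissonKernelHalfSpace (z.fst - u) z.snd ∂μ -
      ∫ u, poissonKernelHalfSpace (z.fst - u) z.snd ∂ν| ≤ poissonGap μ z.fst z.snd := by
  have := hμ.1
  have := hν.1
  refine le_poissonGap hμ hz fun p q hpq => ?_
  have h1 := integral_mono (hμ.2 p) (integrable_poissonKernelHalfSpace hz) fun u => (hpq u).1
  have h2 := integral_mono (integrable_poissonKernelHalfSpace hz) (hμ.2 q) fun u => (hpq u).2
  have h3 := integral_mono (hν.2 p) (integrable_poissonKernelHalfSpace hz) fun u => (hpq u).1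
  have h4 := integral_mono (integrable_poissonKernelHalfSpace hz) (hν.2 q) fun u => (hpq u).2
  have hp := h p
  have hq := h q
  rw [abs_le]
  constructor <;> linarith

/-- The gap is Lipschitz in the Poisson kernel for the uniform norm: shifting enclosing
polynomials by `ε` encloses every kernel within `ε`. -/
lemma poissonGap_le_add (hμ : Admissible μ) {z w : PoissonSpace d} (hz : 0 < z.snd) {ε : ℝ}
    (h : ∀ u, |poissonKernelHalfSpace (w.fst - u) w.snd -
      poissonKernelHalfSpace (z.fst - u) z.snd| ≤ ε) :
    poissonGap μ w.fst w.snd ≤ poissonGap μ z.fst z.snd + 2 * ε * μ.real Set.univ := by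
  have := hμ.1
  rw [← sub_le_iff_le_add]
  refine le_poissonGap hμ hz fun p q hpq => ?_
  have h1 := poissonGap_le hμ (x := w.fst) (t := w.snd) (p := p - MvPolynomial.C ε)
    (q := q + MvPolynomial.C ε) fun u => by
      have h2 := abs_le.1 (h u)
      have h3 := hpq u
      simp only [map_sub, map_add, MvPolynomial.eval_C]
      constructor <;> linarith
  simp only [map_sub, map_add, MvPolynomial.eval_C] at h1
  rw [integral_add (hμ.2 q) (integrable_const _), integral_sub (hμ.2 p) (integrable_const _),
    integral_const, smul_eq_mul] at h1
  linarith

lemma continuousAt_poissonGap (hμ : Admissible μ) {z₀ : PoissonSpace d} (hz₀ : 0 < z₀.snd) :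
    ContinuousAt (fun z : PoissonSpace d => poissonGap μ z.fst z.snd) z₀ := by
  have := hμ.1
  rw [Metric.continuousAt_iff']
  intro ε hε
  set m := μ.real Set.univ with hm
  have hm0 : 0 ≤ m := measureReal_nonneg
  set c := Real.Gamma (((d : ℝ) + 1) / 2) / Real.pi ^ (((d : ℝ) + 1) / 2) with hc
  have hc0 : 0 < c := poissonConstant_pos d
  set δ := ε / (2 * (m + 1)) with hδ
  have hδ0 : 0 < δ := by positivity
  filter_upwards [eventually_abs_poissonProfile_sub_le (poissonExponent_nonneg d) hz₀
    (div_pos hδ0 hc0), continuous_snd_poissonSpace.continuousAt.eventually_const_lt hz₀]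
    with z hz hz0
  have h1 : ∀ u, |poissonKernelHalfSpace (z.fst - u) z.snd -
      poissonKernelHalfSpace (z₀.fst - u) z₀.snd| ≤ δ := fun u => by
    rw [poissonKernelHalfSpace_eq, poissonKernelHalfSpace_eq, ← hc, ← mul_sub, abs_mul,
      abs_of_pos hc0, ← le_div_iff₀' hc0]
    exact hz u
  have h2 := poissonGap_le_add hμ hz₀ h1
  have h3 := poissonGap_le_add hμ hz0 fun u => by
    rw [abs_sub_comm]
    exact h1 u
  have h4 : 2 * δ * m < ε := by
    have : 2 * δ * (m + 1) = ε := by rw [hδ]; field_simp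
    nlinarith
  rw [Real.dist_eq, abs_lt]
  constructor <;> linarith

/-- A determinate measure has vanishing gap: its integral of the Poisson kernel is approximated
by integrals of polynomials from both sides. -/
lemma poissonGap_nonpos_of_determinate (hμ : Admissible μ) (hdet : ¬ MomentIndeterminate μ)
    {z : PoissonSpace d} (hz : 0 < z.snd) : poissonGap μ z.fst z.snd ≤ 0 := by
  obtain ⟨M, hM⟩ := exists_bound_poissonKernelHalfSpace hz
  let f : polyBounded d := ⟨⟨fun u => poissonKernelHalfSpace (z.fst - u) z.snd,
    continuous_poissonKernelHalfSpace hz⟩, mem_polyBounded_of_abs_le (M := M) fun u => by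
      simpa only [ContinuousMap.coe_mk, abs_of_nonneg (hM u).1] using (hM u).2⟩
  have hf : upperIntegral μ f.1 + upperIntegral μ (-f).1 = 0 := by
    rw [upperIntegral_eq_integral hμ hdet, upperIntegral_eq_integral hμ hdet,
      show ∫ u, (-f).1 u ∂μ = -∫ u, f.1 u ∂μ from integral_neg _, add_neg_cancel]
  have h1 : poissonGap μ z.fst z.snd - upperIntegral μ (-f).1 ≤ upperIntegral μ f.1 := by
    refine le_upperIntegral f fun q hq => ?_
    rw [sub_le_comm]
    refine le_upperIntegral (-f) fun p hp => ?_
    have h2 := poissonGap_le hμ (x := z.fst) (t := z.snd) (p := -p) (q := q) fun u =>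
      ⟨by rw [map_neg]; exact neg_le.1 (hp u), hq u⟩
    simp only [map_neg, integral_neg] at h2
    linarith
  linarith

lemma affine_mem_sphere {c : PoissonSpace d} {r : ℝ} (hr : 0 < r)
    (ω : sphere (0 : PoissonSpace d) 1) : c + r • (ω : PoissonSpace d) ∈ sphere c r := by
  rw [mem_sphere, dist_eq_norm, add_sub_cancel_left, norm_smul, norm_eq_of_mem_sphere, mul_one,
    Real.norm_of_nonneg hr.le]

lemma continuous_affine_sphere (c : PoissonSpace d) (r : ℝ) :
    Continuous fun ω : sphere (0 : PoissonSpace d) 1 => c + r • (ω : PoissonSpace d) := by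
  fun_prop

/-- Integration over a sphere, pulled back to the unit sphere. -/
lemma integral_sphereSurfaceMeasure (c : PoissonSpace d) {r : ℝ} (hr : 0 < r)
    (f : PoissonSpace d → ℝ) :
    ∫ z, f z ∂(sphereSurfaceMeasure c r) = r ^ d *
      ∫ ω : sphere (0 : PoissonSpace d) 1, f (c + r • (ω : PoissonSpace d))
        ∂(volume : Measure (PoissonSpace d)).toSphere := by
  have hinj : Function.Injective
      fun ω : sphere (0 : PoissonSpace d) 1 => c + r • (ω : PoissonSpace d) := fun ω ω' h =>
    Subtype.ext (smul_right_injective _ hr.ne' (add_left_cancel h))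
  rw [sphereSurfaceMeasure, integral_smul_measure,
    ((continuous_affine_sphere c r).isClosedEmbedding hinj).measurableEmbedding.integral_map,
    ENNReal.toReal_ofReal (by positivity), smul_eq_mul]

/-- If the gap vanishes at all points of a sphere in the half-space, then so does the difference
of the Poisson transforms of two moment equivalent measures, and the measures coincide. -/
lemma exists_poissonGap_pos_on_sphere (hμ : Admissible μ) (h : MomentIndeterminate μ)
    {c : PoissonSpace d} {r : ℝ} (hr : 0 < r) (hrc : r < c.snd) :
    ∃ z ∈ sphere c r, 0 < poissonGap μ z.fst z.snd := by
  obtain ⟨ν, hν, hmom, hne⟩ := h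
  have := hμ.1
  have := hν.1
  by_contra! hcon
  refine hne (measure_eq_of_integral_poissonProfile_eq μ ν fun z hz =>
    integral_poissonProfile_eq_of_eq_on_sphere hr hrc (fun z hz => ?_) hz).symm
  have hz0 := snd_pos_of_mem_closedBall hrc (sphere_subset_closedBall hz)
  have h1 := (integral_poissonKernelHalfSpace_sub_le_poissonGap hμ hν hmom hz0).trans (hcon z hz)
  have h2 := sub_eq_zero.1 (abs_nonpos_iff.1 h1)
  simp only [poissonKernelHalfSpace_eq, integral_const_mul] at h2
  exact mul_left_cancel₀ (poissonConstant_pos d).ne' h2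

lemma integral_poissonGap_sphere_pos (hμ : Admissible μ) (h : MomentIndeterminate μ)
    {c : PoissonSpace d} {r : ℝ} (hr : 0 < r) (hrc : r < c.snd) :
    0 < ∫ z, poissonGap μ z.fst z.snd ∂(sphereSurfaceMeasure c r) := by
  obtain ⟨z, hz, hzpos⟩ := exists_poissonGap_pos_on_sphere hμ h hr hrc
  have hpos : ∀ ω : sphere (0 : PoissonSpace d) 1, 0 < (c + r • (ω : PoissonSpace d)).snd :=
    fun ω => snd_pos_of_mem_closedBall hrc (sphere_subset_closedBall (affine_mem_sphere hr ω))
  rw [integral_sphereSurfaceMeasure c hr (fun z => poissonGap μ z.fst z.snd)]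
  refine mul_pos (by positivity) ?_
  have hcont : Continuous fun ω : sphere (0 : PoissonSpace d) 1 =>
      poissonGap μ (c + r • (ω : PoissonSpace d)).fst (c + r • (ω : PoissonSpace d)).snd := by
    rw [continuous_iff_continuousAt]
    intro ω
    exact ContinuousAt.comp (f := fun ω : sphere (0 : PoissonSpace d) 1 =>
      c + r • (ω : PoissonSpace d)) (continuousAt_poissonGap hμ (hpos ω))
      (continuous_affine_sphere c r).continuousAt
  have hω : r⁻¹ • (z - c) ∈ sphere (0 : PoissonSpace d) 1 := by
    rw [mem_sphere_zero_iff_norm, norm_smul, ← dist_eq_norm, mem_sphere.1 hz, norm_inv,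
      Real.norm_of_nonneg hr.le, inv_mul_cancel₀ hr.ne']
  refine integral_pos_of_integrable_nonneg_nonzero (x := ⟨r⁻¹ • (z - c), hω⟩) hcont ?_
    (fun ω => poissonGap_nonneg hμ (hpos ω)) ?_
  · exact hcont.integrable_of_hasCompactSupport (HasCompactSupport.of_compactSpace _)
  · simp only [smul_inv_smul₀ hr.ne', add_sub_cancel]
    exact hzpos.ne'

lemma exists_poissonGap_pos_of_integral_pos {c : PoissonSpace d} {r : ℝ} (hr : 0 < r)
    (hrc : r < c.snd) (h : 0 < ∫ z, poissonGap μ z.fst z.snd ∂(sphereSurfaceMeasure c r)) :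
    ∃ z : PoissonSpace d, 0 < z.snd ∧ 0 < poissonGap μ z.fst z.snd := by
  by_contra! hcon
  rw [integral_sphereSurfaceMeasure c hr (fun z => poissonGap μ z.fst z.snd)] at h
  refine h.not_ge (mul_nonpos_of_nonneg_of_nonpos (by positivity) (integral_nonpos fun ω => ?_))
  exact hcon _ (snd_pos_of_mem_closedBall hrc
    (sphere_subset_closedBall (affine_mem_sphere hr ω)))

end

theorem theorem5 (d : ℕ) (hd : 1 ≤ d) (μ : Measure (EuclideanSpace ℝ (Fin d)))
    (hμ : Admissible μ) :
    List.TFAE [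
      MomentIndeterminate μ,
      ∃ (x₀ : EuclideanSpace ℝ (Fin d)) (t₀ : ℝ), 0 < t₀ ∧ 0 < poissonGap μ x₀ t₀,
      ∀ (x₀ : EuclideanSpace ℝ (Fin d)) (t₀ r : ℝ), 0 < r → r < t₀ →
        0 < ∫ z, poissonGap μ z.fst z.snd
          ∂(sphereSurfaceMeasure (WithLp.toLp 2 (x₀, t₀)) r)] := by
  tfae_have 1 → 3 := fun h x₀ t₀ r hr hrt =>
    integral_poissonGap_sphere_pos hμ h (c := WithLp.toLp 2 (x₀, t₀)) hr hrt
  tfae_have 3 → 2 := fun h => by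
    obtain ⟨z, hz, hzpos⟩ := exists_poissonGap_pos_of_integral_pos one_pos one_lt_two
      (h 0 2 1 one_pos one_lt_two)
    exact ⟨z.fst, z.snd, hz, hzpos⟩
  tfae_have 2 → 1 := by
    rintro ⟨x₀, t₀, ht₀, hpos⟩
    by_contra hdet
    exact hpos.not_ge
      (poissonGap_nonpos_of_determinate hμ hdet (z := WithLp.toLp 2 (x₀, t₀)) ht₀)
  tfae_finish
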